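/- All graphs are finite, simple and undirected. A graph on $n$ vertices is called tricyclic if it is connected and has exactly $n+2$ edges. A simple cycle is a cycle in which no vertex is repeated, and simple cycles are counted as subgraphs. The signless Laplacian Estrada index of $G$ is $SLEE(G)=\sum_{i=1}^n e^{q_i}$, where $q_1,\dots,q_n$ are the eigenvalues (with multiplicity) of the signless Laplacian matrix $\mathbf{Q}(G)=\mathbf{D}(G)+\mathbf{A}(G)$, the sum of the diagonal degree matrix and the adjacency matrix. For $j\in\{3,4,6,7\}$ and $n\ge b_j$, where $b_3=7$, $b_4=6$, $b_6=5$, $b_7=4$, let $H_j^n$ be the graph on $n$ vertices obtained by attaching $n-b_j$ pendant vertices to the vertex $z$ of the following base on $b_j$ vertices: - $j=3$: three triangles that share exactly the vertex $z$; - $j=4$: a copy of $K_4$ minus an edge and a triangle that share exactly the vertex $z$, where $z$ has degree $3$ in $K_4$ minus an edge; - $j=6$: three triangles that share exactly one edge, $z$ being an end of this edge; - $j=7$: the complete graph $K_4$, $z$ being any of its vertices. **Theorem.** Let $j\in\{3,4,6,7\}$ and let $G$ be a tricyclic graph on $n$ vertices with exactly $j$ simple cycles. If $SLEE(G')\le SLEE(G)$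 for every tricyclic graph $G'$ on $n$ vertices with exactly $j$ simple cycles, then $G\cong H_j^n$. (There is no tricyclic graph on $n$ vertices with exactly $j$ simple cycles when $n<b_j$.) -/

import Mathlib

namespace Tricyclic

/-- A tricyclic graph: a connected graph with `n` vertices and `n + 2` edges,
that is, a connected graph of cyclomatic number `m - n + 1 = 3`. -/
def IsTricyclic {V : Type*} [Fintype V] (G : SimpleGraph V) : Prop :=
  G.Connected ∧ G.edgeSet.ncard = Fintype.card V + 2

/-- The edge sets of the simple cycles (no repeated vertices) of `G`.  A cycle, as a subgraph, is
determined by its edge set, so the starting point and the orientation of a walk play no role. -/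
def cycleEdgeSets {V : Type*} (G : SimpleGraph V) : Set (Set (Sym2 V)) :=
  {s | ∃ (v : V) (w : G.Walk v v), w.IsCycle ∧ s = w.edgeSet}

/-- The number of simple cycles of `G`. -/
noncomputable def numCycles {V : Type*} (G : SimpleGraph V) : ℕ :=
  (cycleEdgeSets G).ncard

open scoped Classical in
/-- The signless Laplacian matrix `Q = D + A`. -/
noncomputable def signlessLaplacian {V : Type*} [Fintype V] [DecidableEq V]
    (G : SimpleGraph V) : Matrix V V ℝ :=
  G.degMatrix ℝ + G.adjMatrix ℝ

theorem signlessLaplacian_isHermitian {V : Type*} [Fintype V] [DecidableEq V]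
    (G : SimpleGraph V) : (signlessLaplacian G).IsHermitian := by
  classical
  unfold signlessLaplacian
  rw [Matrix.IsHermitian, Matrix.conjTranspose_eq_transpose_of_trivial, Matrix.transpose_add,
    SimpleGraph.transpose_adjMatrix, SimpleGraph.degMatrix, Matrix.diagonal_transpose]

/-- The signless Laplacian Estrada index: the sum of `exp q` over the eigenvalues `q` of the
signless Laplacian, counted with multiplicity. -/
noncomputable def SLEE {V : Type*} [Fintype V] [DecidableEq V] (G : SimpleGraph V) : ℝ :=
  ∑ i, Real.exp ((signlessLaplacian_isHermitian G).eigenvalues i)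

/-- The edges of the base of `H_j^n` that avoid the centre, which is the vertex `0`. -/
def outerEdges : ℕ → List (ℕ × ℕ)
  | 3 => [(1, 2), (3, 4), (5, 6)]
  | 4 => [(1, 2), (2, 3), (4, 5)]
  | 6 => [(1, 2), (1, 3), (1, 4)]
  | 7 => [(1, 2), (1, 3), (2, 3)]
  | _ => []

/-- The graph `H_j^n` on the vertices `0, …, n - 1`, for `j = 3, 4, 6, 7`
and `n ≥ 7, 6, 5, 4` respectively.  The centre `0` is adjacent to all other vertices, and besides
there are the three edges of `outerEdges j`.  So the base consists of
* `j = 3`: three triangles with the common vertex `0`;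
* `j = 4`: a `K₄` minus an edge and a triangle, with the common vertex `0`, which is one of the
  two vertices of degree three of `K₄` minus an edge;
* `j = 6`: three triangles with the common edge `{0, 1}`;
* `j = 7`: a `K₄`;
and every other vertex is a pendant vertex attached to `0`. -/
def extremalGraph (j n : ℕ) : SimpleGraph (Fin n) :=
  SimpleGraph.fromRel fun a b => a.val = 0 ∨ (a.val, b.val) ∈ outerEdges j

end Tricyclic

/-! Expanding the exponential gives SLEE(G) = Σ_k tr(Q^k)/k!, so it suffices to compare traces of
powers. A Kelmans transformation (the edges vw with w not adjacent to u are moved to u) makes all of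
them at least as large: after e_u, e_v are replaced by their sum and difference, the entries of Q(G)
are bounded in absolute value by those of Q(G') (`IsKelmans.abs_conj_le`). The growth is strict if u
and v both have private neighbours (`IsKelmans.SLEE_lt`).

Such a move may change the number of cycles, so that number is replaced by a weaker condition that
survives. Even edge sets are functions into `ZMod 2`, with symmetric difference as sum and
intersection as product; a coloop is a nonempty even set that every even set contains or avoids. A
tricyclic graph has at least 2^3 even sets, each a disjoint union of circuits; counting these
families shows that at most 3 cycles force two coloops and at most 4 cycles force one. Moves between
adjacent vertices preserve connectedness, the number of edges and the presence of one or of two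
coloops (`KelmansRel.exists_isColoop`).

A maximiser in such a class has a dominating vertex z, since otherwise a vertex of maximum degree
admits a strict move. The three edges that avoid z form 3K_2, P_3 + K_2, P_4, K_{1,3} or K_3. The
last three types have no coloop, and P_3 + K_2 has at most one. Further moves show 3K_2 < P_3 + K_2
< K_{1,3} and P_4 < K_{1,3}, while K_{1,3} and K_3 have equal index by a switching. Hence the
maximisers are 3K_2 with two coloops, P_3 + K_2 with one, and K_{1,3} or K_3 without restriction;
they have 3, 4, 6 and 7 cycles. So G, maximal among graphs with j cycles, is maximal in the larger
class as well, and this determines its type. -/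

namespace Tricyclic

open SimpleGraph Matrix

/-! ### The Estrada index through traces of powers -/

section Trace

variable {V : Type*} [Fintype V] [DecidableEq V]

theorem trace_pow_eq_sum_eigenvalues_pow {A : Matrix V V ℝ} (hA : A.IsHermitian) (k : ℕ) :
    (A ^ k).trace = ∑ i, hA.eigenvalues i ^ k := by
  conv_lhs => rw [hA.spectral_theorem]
  rw [← map_pow, Unitary.conjStarAlgAut_apply, Matrix.trace_mul_cycle]
  simp [Matrix.diagonal_pow, Matrix.trace]

theorem hasSum_SLEE (G : SimpleGraph V) :
    HasSum (fun k : ℕ => ((signlessLaplacian G) ^ k).trace / (k.factorial : ℝ)) (SLEE G) := by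
  have h : ∀ i, HasSum (fun k : ℕ => (signlessLaplacian_isHermitian G).eigenvalues i ^ k /
      (k.factorial : ℝ)) (Real.exp ((signlessLaplacian_isHermitian G).eigenvalues i)) := by
    intro i
    rw [Real.exp_eq_exp_ℝ]
    exact NormedSpace.expSeries_div_hasSum_exp _
  have := hasSum_sum (s := Finset.univ) fun i _ => h i
  unfold SLEE
  convert this using 2 with k
  rw [trace_pow_eq_sum_eigenvalues_pow (signlessLaplacian_isHermitian G), Finset.sum_div]

theorem SLEE_lt_of_trace_pow {G G' : SimpleGraph V}
    (h : ∀ k : ℕ, ((signlessLaplacian G) ^ k).trace ≤ ((signlessLaplacian G') ^ k).trace)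
    (k₀ : ℕ) (h₀ : ((signlessLaplacian G) ^ k₀).trace < ((signlessLaplacian G') ^ k₀).trace) :
    SLEE G < SLEE G' := by
  refine hasSum_lt (i := k₀) (fun k => ?_) ?_ (hasSum_SLEE G) (hasSum_SLEE G')
  · exact div_le_div_of_nonneg_right (h k) (by positivity)
  · exact div_lt_div_of_pos_right h₀ (by positivity)

theorem SLEE_eq_of_trace_pow {G G' : SimpleGraph V}
    (h : ∀ k : ℕ, ((signlessLaplacian G) ^ k).trace = ((signlessLaplacian G') ^ k).trace) :
    SLEE G = SLEE G' := by
  refine (hasSum_SLEE G).unique ?_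
  simpa only [h] using hasSum_SLEE G'

/-- `P` need not be orthogonal, which allows the unnormalised basis change `sumDiff`. -/
theorem trace_pow_of_conj {A B P P' : Matrix V V ℝ} (hP : P * P' = 1) (h : B = P' * A * P)
    (k : ℕ) : (B ^ k).trace = (A ^ k).trace := by
  have hB : B ^ k = P' * A ^ k * P := by
    have hP' : P' * P = 1 := mul_eq_one_comm.mp hP
    induction k with
    | zero => simp [hP']
    | succ k ih =>
      rw [pow_succ, ih, h, pow_succ]
      calc P' * A ^ k * P * (P' * A * P) = P' * A ^ k * (P * P') * A * P := by
            simp only [Matrix.mul_assoc]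
        _ = _ := by rw [hP, Matrix.mul_one]; simp only [Matrix.mul_assoc]
  rw [hB, Matrix.trace_mul_cycle, hP, Matrix.one_mul]

theorem abs_pow_apply_le {A B : Matrix V V ℝ} (h : ∀ i j, |A i j| ≤ B i j) (k : ℕ) (i j : V) :
    |(A ^ k) i j| ≤ (B ^ k) i j := by
  induction k generalizing i j with
  | zero => by_cases hij : i = j <;> simp [hij]
  | succ k ih =>
    rw [pow_succ, pow_succ, Matrix.mul_apply, Matrix.mul_apply]
    refine (Finset.abs_sum_le_sum_abs _ _).trans (Finset.sum_le_sum fun l _ => ?_)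
    rw [abs_mul]
    exact mul_le_mul (ih i l) (h l j) (abs_nonneg _) ((abs_nonneg _).trans (ih i l))

theorem trace_pow_le_of_abs_le {A B : Matrix V V ℝ} (h : ∀ i j, |A i j| ≤ B i j) (k : ℕ) :
    (A ^ k).trace ≤ (B ^ k).trace :=
  Finset.sum_le_sum fun i _ => (le_abs_self _).trans (abs_pow_apply_le h k i i)

theorem trace_sq_lt_of_abs_le {A B : Matrix V V ℝ} (h : ∀ i j, |A i j| ≤ B i j) {u v : V}
    (huv : A u v * A v u < B u v * B v u) : (A ^ 2).trace < (B ^ 2).trace := by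
  have key : ∀ i j, A i j * A j i ≤ B i j * B j i := fun i j =>
    (le_abs_self _).trans (by
      rw [abs_mul]
      exact mul_le_mul (h i j) (h j i) (abs_nonneg _) ((abs_nonneg _).trans (h i j)))
  simp only [pow_two, Matrix.trace, Matrix.diag_apply, Matrix.mul_apply]
  refine Finset.sum_lt_sum (fun i _ => Finset.sum_le_sum fun j _ => key i j)
    ⟨u, Finset.mem_univ _, ?_⟩
  exact Finset.sum_lt_sum (fun j _ => key u j) ⟨v, Finset.mem_univ _, huv⟩

end Trace

/-! ### Entries of the signless Laplacian -/

section Entries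

variable {V : Type*}

open scoped Classical in
/-- The adjacency indicator of a graph. -/
noncomputable def adjInd (G : SimpleGraph V) (x y : V) : ℝ := if G.Adj x y then 1 else 0

theorem adjInd_of_adj {G : SimpleGraph V} {x y : V} (h : G.Adj x y) : adjInd G x y = 1 :=
  if_pos h

theorem adjInd_of_not_adj {G : SimpleGraph V} {x y : V} (h : ¬ G.Adj x y) : adjInd G x y = 0 :=
  if_neg h

@[simp] theorem adjInd_self (G : SimpleGraph V) (x : V) : adjInd G x x = 0 :=
  if_neg (G.loopless.irrefl x)

theorem adjInd_congr {G G' : SimpleGraph V} {x y x' y' : V} (h : G.Adj x y ↔ G'.Adj x' y') :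
    adjInd G x y = adjInd G' x' y' := by
  by_cases h' : G.Adj x y
  · rw [adjInd_of_adj h', adjInd_of_adj (h.1 h')]
  · rw [adjInd_of_not_adj h', adjInd_of_not_adj (mt h.2 h')]

theorem adjInd_comm (G : SimpleGraph V) (x y : V) : adjInd G x y = adjInd G y x :=
  adjInd_congr (G.adj_comm x y)

theorem adjInd_nonneg (G : SimpleGraph V) (x y : V) : 0 ≤ adjInd G x y := by
  unfold adjInd; split_ifs <;> norm_num

variable [Fintype V]

/-- The degree of a vertex as a real number. -/
noncomputable def realDegree (G : SimpleGraph V) (x : V) : ℝ := ∑ y, adjInd G x y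

theorem adjInd_le_realDegree (G : SimpleGraph V) (x y : V) : adjInd G x y ≤ realDegree G x :=
  Finset.single_le_sum (f := fun y => adjInd G x y) (fun z _ => adjInd_nonneg G x z)
    (Finset.mem_univ y)

theorem realDegree_eq_card {G : SimpleGraph V} {x : V} (s : Finset V)
    (hs : ∀ y, G.Adj x y ↔ y ∈ s) : realDegree G x = s.card := by
  classical
  simp [realDegree, adjInd, hs]

theorem signlessLaplacian_apply [DecidableEq V] (G : SimpleGraph V) (x y : V) :
    signlessLaplacian G x y = (if x = y then realDegree G x else 0) + adjInd G x y := by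
  classical
  simp only [signlessLaplacian, Matrix.add_apply, SimpleGraph.degMatrix, Matrix.diagonal_apply,
    SimpleGraph.adjMatrix_apply]
  congr 1
  split_ifs with h
  · rw [realDegree_eq_card (G.neighborFinset x) (by simp)]; simp
  · rfl

theorem two_mul_ncard_edgeSet (G : SimpleGraph V) :
    2 * (G.edgeSet.ncard : ℝ) = ∑ x, realDegree G x := by
  classical
  have h := G.sum_degrees_eq_twice_card_edges
  have h2 : G.edgeSet.ncard = G.edgeFinset.card := by
    rw [← G.coe_edgeFinset, Set.ncard_coe_finset]
  rw [h2]
  have : ∀ x, realDegree G x = G.degree x := fun x => by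
    rw [realDegree_eq_card (G.neighborFinset x) (by simp)]; simp
  simp only [this]
  exact_mod_cast h.symm

end Entries

/-! ### The Kelmans transformation -/

/-- `G'` arises from `G` by moving to `u` all edges `vw` for which `uw` is not an edge. -/
structure IsKelmans {V : Type*} (G G' : SimpleGraph V) (u v : V) : Prop where
  ne : u ≠ v
  adj_uv : G'.Adj u v ↔ G.Adj u v
  adj_u : ∀ w, w ≠ u → w ≠ v → (G'.Adj u w ↔ G.Adj u w ∨ G.Adj v w)
  adj_v : ∀ w, w ≠ u → w ≠ v → (G'.Adj v w ↔ G.Adj u w ∧ G.Adj v w)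
  adj_rest : ∀ x y, x ≠ u → x ≠ v → y ≠ u → y ≠ v → (G'.Adj x y ↔ G.Adj x y)

namespace IsKelmans

variable {V : Type*} {G G' : SimpleGraph V} {u v : V}

theorem adjInd_uv (h : IsKelmans G G' u v) : adjInd G' u v = adjInd G u v :=
  adjInd_congr h.adj_uv

theorem adjInd_rest (h : IsKelmans G G' u v) {x y : V} (hxu : x ≠ u) (hxv : x ≠ v) (hyu : y ≠ u)
    (hyv : y ≠ v) : adjInd G' x y = adjInd G x y :=
  adjInd_congr (h.adj_rest x y hxu hxv hyu hyv)

theorem adjInd_add (h : IsKelmans G G' u v) {w : V} (hu : w ≠ u) (hv : w ≠ v) :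
    adjInd G' u w + adjInd G' v w = adjInd G u w + adjInd G v w := by
  have hu' := h.adj_u w hu hv
  have hv' := h.adj_v w hu hv
  by_cases h1 : G.Adj u w <;> by_cases h2 : G.Adj v w <;> simp [adjInd, h1, h2, hu', hv']

theorem abs_adjInd_sub_le (h : IsKelmans G G' u v) {w : V} (hu : w ≠ u) (hv : w ≠ v) :
    |adjInd G u w - adjInd G v w| ≤ adjInd G' u w - adjInd G' v w := by
  have hu' := h.adj_u w hu hv
  have hv' := h.adj_v w hu hv
  by_cases h1 : G.Adj u w <;> by_cases h2 : G.Adj v w <;> simp [adjInd, h1, h2, hu', hv']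

variable [Fintype V]

theorem realDegree_add (h : IsKelmans G G' u v) :
    realDegree G' u + realDegree G' v = realDegree G u + realDegree G v := by
  simp only [realDegree, ← Finset.sum_add_distrib]
  refine Finset.sum_congr rfl fun w _ => ?_
  by_cases hu : w = u
  · subst hu; simp [adjInd_comm _ v, h.adjInd_uv]
  by_cases hv : w = v
  · subst hv; simp [h.adjInd_uv]
  exact h.adjInd_add hu hv

theorem abs_realDegree_sub_le (h : IsKelmans G G' u v) :
    |realDegree G u - realDegree G v| ≤ realDegree G' u - realDegree G' v := by
  classical
  have e : ∀ H : SimpleGraph V, realDegree H u - realDegree H v =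
      ∑ w ∈ (Finset.univ.erase u).erase v, (adjInd H u w - adjInd H v w) := by
    intro H
    rw [realDegree, realDegree, ← Finset.sum_sub_distrib]
    rw [← Finset.add_sum_erase _ _ (Finset.mem_univ u),
      ← Finset.add_sum_erase _ _ (Finset.mem_erase.2 ⟨h.ne.symm, Finset.mem_univ v⟩)]
    simp [adjInd_comm _ v u]
  rw [e, e]
  refine (Finset.abs_sum_le_sum_abs _ _).trans (Finset.sum_le_sum fun w hw => ?_)
  simp only [Finset.mem_erase, Finset.mem_univ, and_true] at hw
  exact h.abs_adjInd_sub_le hw.2 hw.1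

/-- In `G'` every private neighbour contributes +1 to the difference. Hence `a`, private to `u`,
makes the lower bound strict, and `b`, private to `v`, the upper one. -/
theorem abs_realDegree_sub_lt (h : IsKelmans G G' u v) {a b : V} (hau : G.Adj u a)
    (hav : ¬ G.Adj v a) (hav' : a ≠ v) (hbv : G.Adj v b) (hbu : ¬ G.Adj u b) (hbu' : b ≠ u) :
    |realDegree G u - realDegree G v| < realDegree G' u - realDegree G' v := by
  classical
  have e : ∀ H : SimpleGraph V, realDegree H u - realDegree H v =
      ∑ w ∈ (Finset.univ.erase u).erase v, (adjInd H u w - adjInd H v w) := by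
    intro H
    rw [realDegree, realDegree, ← Finset.sum_sub_distrib]
    rw [← Finset.add_sum_erase _ _ (Finset.mem_univ u),
      ← Finset.add_sum_erase _ _ (Finset.mem_erase.2 ⟨h.ne.symm, Finset.mem_univ v⟩)]
    simp [adjInd_comm _ v u]
  have hau' : a ≠ u := fun h' => G.loopless.irrefl u (h' ▸ hau)
  have hbv' : b ≠ v := fun h' => G.loopless.irrefl v (h' ▸ hbv)
  have le : ∀ w ∈ (Finset.univ.erase u).erase v,
      |adjInd G u w - adjInd G v w| ≤ adjInd G' u w - adjInd G' v w := fun w hw => by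
    simp only [Finset.mem_erase, Finset.mem_univ, and_true] at hw
    exact h.abs_adjInd_sub_le hw.2 hw.1
  rw [e, e, abs_lt, ← Finset.sum_neg_distrib]
  constructor
  · refine Finset.sum_lt_sum (fun w hw => neg_le_of_abs_le (le w hw)) ⟨a, by simp [hau', hav'], ?_⟩
    rw [adjInd_of_adj hau, adjInd_of_not_adj hav, adjInd_of_adj ((h.adj_u a hau' hav').2 (.inl hau)),
      adjInd_of_not_adj (fun h' => hav ((h.adj_v a hau' hav').1 h').2)]
    norm_num
  · refine Finset.sum_lt_sum (fun w hw => le_of_abs_le (le w hw)) ⟨b, by simp [hbu', hbv'], ?_⟩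
    rw [adjInd_of_adj hbv, adjInd_of_not_adj hbu, adjInd_of_adj ((h.adj_u b hbu' hbv').2 (.inr hbv)),
      adjInd_of_not_adj (fun h' => hbu ((h.adj_v b hbu' hbv').1 h').1)]
    norm_num

theorem realDegree_rest (h : IsKelmans G G' u v) {x : V} (hu : x ≠ u) (hv : x ≠ v) :
    realDegree G' x = realDegree G x := by
  classical
  rw [realDegree, realDegree]
  have huv := h.ne
  rw [← Finset.add_sum_erase _ _ (Finset.mem_univ u),
    ← Finset.add_sum_erase _ _ (Finset.mem_erase.2 ⟨huv.symm, Finset.mem_univ v⟩),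
    ← Finset.add_sum_erase _ _ (Finset.mem_univ u),
    ← Finset.add_sum_erase _ _ (Finset.mem_erase.2 ⟨huv.symm, Finset.mem_univ v⟩),
    ← add_assoc, ← add_assoc]
  congr 1
  · simpa only [adjInd_comm _ x] using h.adjInd_add hu hv
  · refine Finset.sum_congr rfl fun y hy => ?_
    simp only [Finset.mem_erase, Finset.mem_univ, and_true] at hy
    exact h.adjInd_rest hu hv hy.2 hy.1

theorem ncard_edgeSet (h : IsKelmans G G' u v) : G'.edgeSet.ncard = G.edgeSet.ncard := by
  classical
  have : 2 * (G'.edgeSet.ncard : ℝ) = 2 * (G.edgeSet.ncard : ℝ) := by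
    rw [two_mul_ncard_edgeSet, two_mul_ncard_edgeSet,
      ← Finset.add_sum_erase _ _ (Finset.mem_univ u),
      ← Finset.add_sum_erase _ _ (Finset.mem_erase.2 ⟨h.ne.symm, Finset.mem_univ v⟩),
      ← Finset.add_sum_erase _ _ (Finset.mem_univ u),
      ← Finset.add_sum_erase _ _ (Finset.mem_erase.2 ⟨h.ne.symm, Finset.mem_univ v⟩),
      ← add_assoc, ← add_assoc, h.realDegree_add]
    congr 1
    refine Finset.sum_congr rfl fun y hy => ?_
    simp only [Finset.mem_erase, Finset.mem_univ, and_true] at hy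
    exact h.realDegree_rest hy.2 hy.1
  exact_mod_cast mul_left_cancel₀ two_ne_zero this

end IsKelmans

/-! ### The basis of sums and differences at two vertices -/

section SumDiff

variable {V : Type*} [Fintype V] [DecidableEq V]

/-- The change of basis to the sum and the difference of two coordinates. -/
def sumDiff (u v : V) : Matrix V V ℝ := fun i k =>
  if i = u then (if k = u then 1 else 0) + (if k = v then 1 else 0)
  else if i = v then (if k = u then 1 else 0) - (if k = v then 1 else 0)
  else if i = k then 1 else 0

/-- The inverse of `sumDiff`. -/
noncomputable def sumDiffInv (u v : V) : Matrix V V ℝ := fun i k =>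
  if i = u then ((if k = u then 1 else 0) + (if k = v then 1 else 0)) / 2
  else if i = v then ((if k = u then 1 else 0) - (if k = v then 1 else 0)) / 2
  else if i = k then 1 else 0

theorem sumDiffInv_mul_apply (u v : V) (A : Matrix V V ℝ) (i j : V) :
    (sumDiffInv u v * A) i j = if i = u then (A u j + A v j) / 2
      else if i = v then (A u j - A v j) / 2 else A i j := by
  rw [Matrix.mul_apply]
  unfold sumDiffInv
  split_ifs
  · simp [add_div, add_mul, Finset.sum_add_distrib, ite_div]; ring
  · simp [sub_div, sub_mul, Finset.sum_sub_distrib, ite_div]; ring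
  · simp

theorem mul_sumDiff_apply {u v : V} (huv : u ≠ v) (A : Matrix V V ℝ) (i j : V) :
    (A * sumDiff u v) i j = if j = u then A i u + A i v
      else if j = v then A i u - A i v else A i j := by
  rw [Matrix.mul_apply, ← Finset.add_sum_erase _ _ (Finset.mem_univ u),
    ← Finset.add_sum_erase _ _ (Finset.mem_erase.2 ⟨huv.symm, Finset.mem_univ v⟩)]
  have hs : ∑ k ∈ (Finset.univ.erase u).erase v, A i k * sumDiff u v k j =
      ∑ k ∈ (Finset.univ.erase u).erase v, if k = j then A i j else 0 := by
    refine Finset.sum_congr rfl fun k hk => ?_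
    simp only [Finset.mem_erase, Finset.mem_univ, and_true] at hk
    simp only [sumDiff, hk.1, hk.2, if_false]
    split_ifs with h <;> simp [h]
  rw [hs, Finset.sum_ite_eq']
  by_cases h1 : j = u
  · subst h1; simp [sumDiff, huv, huv.symm]
  by_cases h2 : j = v
  · subst h2; simp [sumDiff, huv.symm]; ring
  simp [sumDiff, huv.symm, h1, h2]

theorem sumDiff_mul_sumDiffInv {u v : V} (huv : u ≠ v) :
    sumDiff u v * sumDiffInv u v = 1 := by
  refine mul_eq_one_comm.mp ?_
  ext i j
  rw [mul_sumDiff_apply huv]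
  simp only [Matrix.one_apply, sumDiffInv]
  have := huv.symm
  by_cases h1 : i = u <;> by_cases h2 : i = v <;> by_cases h3 : j = u <;> by_cases h4 : j = v <;>
    simp_all <;> grind

theorem sumDiffInv_mul_mul_sumDiff_apply {u v : V} (huv : u ≠ v) (A : Matrix V V ℝ) (i j : V) :
    (sumDiffInv u v * A * sumDiff u v) i j =
      if i = u then
        if j = u then (A u u + A v u + (A u v + A v v)) / 2
        else if j = v then (A u u + A v u - (A u v + A v v)) / 2 else (A u j + A v j) / 2
      else if i = v then
        if j = u then (A u u - A v u + (A u v - A v v)) / 2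
        else if j = v then (A u u - A v u - (A u v - A v v)) / 2 else (A u j - A v j) / 2
      else
        if j = u then A i u + A i v else if j = v then A i u - A i v else A i j := by
  rw [mul_sumDiff_apply huv]
  simp only [sumDiffInv_mul_apply]
  split_ifs <;> ring

end SumDiff

namespace IsKelmans

variable {V : Type*} [Fintype V] [DecidableEq V] {G G' : SimpleGraph V} {u v : V}

/-- Only the entries that pair the difference coordinate with another one change, and these are
controlled by `abs_adjInd_sub_le` and `abs_realDegree_sub_le`. All other entries are nonnegative and
agree for both graphs; for the difference with itself the entry is (d_u + d_v)/2 - a_uv, nonnegative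
because a_uv is at most either degree. -/
theorem abs_conj_le (h : IsKelmans G G' u v) (i j : V) :
    |(sumDiffInv u v * signlessLaplacian G * sumDiff u v) i j| ≤
      (sumDiffInv u v * signlessLaplacian G' * sumDiff u v) i j := by
  have huv := h.ne
  have hvu := huv.symm
  have hadd := h.realDegree_add
  have hsub := h.abs_realDegree_sub_le
  have e := h.adjInd_uv
  have n1 := adjInd_nonneg G u v
  have d1 := adjInd_le_realDegree G u v
  have d2 := adjInd_le_realDegree G v u
  rw [adjInd_comm] at d2
  rw [sumDiffInv_mul_mul_sumDiff_apply huv, sumDiffInv_mul_mul_sumDiff_apply huv]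
  simp only [signlessLaplacian_apply]
  by_cases h1 : i = u
  · subst h1
    by_cases h3 : j = i
    · subst h3
      simp [huv, hvu, adjInd_comm _ v j]
      rw [abs_le]; constructor <;> linarith
    · by_cases h4 : j = v
      · subst h4
        simp [huv, hvu, adjInd_comm _ j i]
        rw [abs_le] at hsub ⊢; constructor <;> linarith
      · have := h.adjInd_add h3 h4
        have p1 := adjInd_nonneg G i j
        have p2 := adjInd_nonneg G v j
        simp [h3, h4, Ne.symm h3, Ne.symm h4]
        rw [abs_le]; constructor <;> linarith
  · by_cases h2 : i = v
    · subst h2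
      by_cases h3 : j = u
      · subst h3
        simp [huv, hvu, adjInd_comm _ i j]
        rw [abs_le] at hsub ⊢; constructor <;> linarith
      · by_cases h4 : j = i
        · subst h4
          simp [huv, hvu, adjInd_comm _ j u]
          rw [abs_le]; constructor <;> linarith
        · have := h.abs_adjInd_sub_le h3 h4
          simp [h3, h4, Ne.symm h3, Ne.symm h4, hvu]
          rw [abs_le] at this ⊢; constructor <;> linarith
    · by_cases h3 : j = u
      · subst h3
        have := h.adjInd_add h1 h2
        have p1 := adjInd_nonneg G j i
        have p2 := adjInd_nonneg G v i
        simp [h1, h2, adjInd_comm _ i]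
        rw [abs_le]; constructor <;> linarith
      · by_cases h4 : j = v
        · subst h4
          have := h.abs_adjInd_sub_le h1 h2
          simp [h1, h2, hvu, adjInd_comm _ i]
          rw [abs_le] at this ⊢; constructor <;> linarith
        · simp only [h1, h2, h3, h4, if_false, h.adjInd_rest h1 h2 h3 h4, h.realDegree_rest h1 h2]
          refine (abs_of_nonneg ?_).le
          have := adjInd_le_realDegree G i j
          have := adjInd_nonneg G i j
          split_ifs <;> linarith

/-- The Kelmans transformation increases the signless Laplacian Estrada index, provided that it
changes the graph essentially. -/
theorem SLEE_lt (h : IsKelmans G G' u v) {a b : V} (hau : G.Adj u a)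
    (hav : ¬ G.Adj v a) (hav' : a ≠ v) (hbv : G.Adj v b) (hbu : ¬ G.Adj u b) (hbu' : b ≠ u) :
    SLEE G < SLEE G' := by
  have tr : ∀ (H : SimpleGraph V) (k : ℕ), ((signlessLaplacian H) ^ k).trace =
      ((sumDiffInv u v * signlessLaplacian H * sumDiff u v) ^ k).trace := fun H k =>
    (trace_pow_of_conj (sumDiff_mul_sumDiffInv h.ne) rfl k).symm
  refine SLEE_lt_of_trace_pow (fun k => ?_) 2 ?_
  · rw [tr, tr]; exact trace_pow_le_of_abs_le h.abs_conj_le k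
  · rw [tr, tr]
    -- The entries at (u, v) and (v, u) are half the degree difference, which grows strictly; so the
    -- second power already separates the traces.
    refine trace_sq_lt_of_abs_le h.abs_conj_le (u := u) (v := v) ?_
    have hlt := h.abs_realDegree_sub_lt hau hav hav' hbv hbu hbu'
    rw [sumDiffInv_mul_mul_sumDiff_apply h.ne, sumDiffInv_mul_mul_sumDiff_apply h.ne,
      sumDiffInv_mul_mul_sumDiff_apply h.ne, sumDiffInv_mul_mul_sumDiff_apply h.ne]
    simp only [signlessLaplacian_apply]
    simp [h.ne, h.ne.symm, adjInd_comm _ v u]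
    have := mul_self_lt_mul_self (abs_nonneg _) hlt
    rw [abs_mul_abs_self] at this
    nlinarith

end IsKelmans

/-! ### The cycle space over `ZMod 2` -/

section EvenSpace

variable {V : Type*} [Fintype V]

/-- The even edge sets of `G`, as functions with values in `ZMod 2`. -/
def evenSpace (G : SimpleGraph V) : Submodule (ZMod 2) (Sym2 V → ZMod 2) where
  carrier := {d | (∀ e, e ∉ G.edgeSet → d e = 0) ∧ ∀ v, ∑ w, d s(v, w) = 0}
  add_mem' := by
    rintro a b ⟨ha, ha'⟩ ⟨hb, hb'⟩
    refine ⟨fun e he => by simp [ha e he, hb e he], fun v => ?_⟩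
    simp [Finset.sum_add_distrib, ha', hb']
  zero_mem' := ⟨fun _ _ => rfl, fun v => by simp⟩
  smul_mem' := by
    rintro c a ⟨ha, ha'⟩
    refine ⟨fun e he => by simp [ha e he], fun v => ?_⟩
    simp [← Finset.mul_sum, ha']

theorem adj_of_mem_evenSpace {G : SimpleGraph V} {d : Sym2 V → ZMod 2} (hd : d ∈ evenSpace G)
    {x y : V} (h : d s(x, y) ≠ 0) : G.Adj x y := by
  by_contra h'
  exact h (hd.1 _ h')

theorem eq_zero_of_not_adj {G : SimpleGraph V} {d : Sym2 V → ZMod 2} (hd : d ∈ evenSpace G)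
    {x y : V} (h : ¬ G.Adj x y) : d s(x, y) = 0 := hd.1 _ h

theorem diag_of_mem_evenSpace {G : SimpleGraph V} {d : Sym2 V → ZMod 2} (hd : d ∈ evenSpace G)
    (x : V) : d s(x, x) = 0 := eq_zero_of_not_adj hd (G.loopless.irrefl x)

theorem zmod_two_eq_one {x : ZMod 2} (h : x ≠ 0) : x = 1 := by
  revert x; decide

theorem zmod_two_mul_self (x : ZMod 2) : x * x = x := by
  revert x; decide

/-- An even edge set with a single other edge at a vertex contains that edge as well. -/
theorem exists_ne_of_mem_evenSpace {G : SimpleGraph V} {d : Sym2 V → ZMod 2}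
    (hd : d ∈ evenSpace G) {x y : V} (h : d s(x, y) ≠ 0) :
    ∃ w, w ≠ y ∧ w ≠ x ∧ d s(x, w) ≠ 0 := by
  by_contra! hcon
  have := hd.2 x
  rw [Finset.sum_eq_single y (fun w _ hw => ?_) (by simp)] at this
  · exact h this
  · by_cases hwx : w = x
    · subst hwx; exact diag_of_mem_evenSpace hd w
    · exact hcon w hw hwx

/-- A nonempty even edge set which every even edge set either contains or avoids. -/
structure IsColoop (G : SimpleGraph V) (c : Sym2 V → ZMod 2) : Prop where
  mem : c ∈ evenSpace G
  ne_zero : c ≠ 0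
  dichotomy : ∀ d ∈ evenSpace G, c * d = 0 ∨ c * d = c

/-- Two coloops that meet are contained in each other. -/
theorem IsColoop.mul_eq_zero {G : SimpleGraph V} {c₁ c₂ : Sym2 V → ZMod 2} (h₁ : IsColoop G c₁)
    (h₂ : IsColoop G c₂) (hne : c₁ ≠ c₂) : c₁ * c₂ = 0 := by
  rcases h₁.dichotomy c₂ h₂.mem with h | h
  · exact h
  rcases h₂.dichotomy c₁ h₁.mem with h' | h'
  · rw [mul_comm]; exact h'
  · rw [mul_comm] at h'; exact absurd (h.symm.trans h') hne

variable [DecidableEq V]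

/-- The edge set of a triangle. -/
def triangle (u v w : V) : Sym2 V → ZMod 2 :=
  Pi.single s(u, v) 1 + Pi.single s(v, w) 1 + Pi.single s(w, u) 1

theorem sum_single_edge {a b : V} (hab : a ≠ b) (x : V) :
    ∑ w, (Pi.single s(a, b) 1 : Sym2 V → ZMod 2) s(x, w) =
      (if x = a then 1 else 0) + (if x = b then 1 else 0) := by
  by_cases h1 : x = a
  · subst h1
    rw [Finset.sum_eq_single b]
    · simp [hab]
    · intro w _ hw
      simp [hw, hab]
    · simp
  by_cases h2 : x = b
  · subst h2
    rw [Finset.sum_eq_single a]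
    · simp [h1, Sym2.eq_swap]
    · intro w _ hw
      simp [hw, h1]
    · simp
  simp [h1, h2]

theorem triangle_mem {G : SimpleGraph V} {u v w : V} (huv : G.Adj u v) (hvw : G.Adj v w)
    (hwu : G.Adj w u) : triangle u v w ∈ evenSpace G := by
  refine ⟨fun e he => ?_, fun x => ?_⟩
  · have h1 : e ≠ s(u, v) := fun h => he (h ▸ huv)
    have h2 : e ≠ s(v, w) := fun h => he (h ▸ hvw)
    have h3 : e ≠ s(w, u) := fun h => he (h ▸ hwu)
    simp [triangle, h1, h2, h3]
  · simp only [triangle, Pi.add_apply, Finset.sum_add_distrib]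
    rw [sum_single_edge huv.ne, sum_single_edge hvw.ne, sum_single_edge hwu.ne]
    generalize (if x = u then (1 : ZMod 2) else 0) = a
    generalize (if x = v then (1 : ZMod 2) else 0) = b
    generalize (if x = w then (1 : ZMod 2) else 0) = c
    revert a b c; decide

/-- A coloop contains no edge of a triangle that shares another edge with a second triangle. -/
theorem IsColoop.eq_zero_of_diamond {G : SimpleGraph V} {c : Sym2 V → ZMod 2} (hc : IsColoop G c)
    {u v w₁ w₂ : V} (huv : G.Adj u v) (hu₁ : G.Adj u w₁) (hv₁ : G.Adj v w₁) (hu₂ : G.Adj u w₂)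
    (hv₂ : G.Adj v w₂) (hne : w₁ ≠ w₂) : c s(v, w₁) = 0 := by
  by_contra h
  -- If `c` contains `vw₁`, it meets the first triangle and so lies inside it. Evenness at `v` then
  -- puts `uv` into `c`, so `c` also lies inside the second triangle, which does not contain `vw₁`.
  have h₁ : c * triangle u v w₁ = c := by
    refine (hc.dichotomy _ (triangle_mem huv hv₁ hu₁.symm)).resolve_left fun h0 => h ?_
    have := congrFun h0 s(v, w₁)
    simpa [triangle, huv.ne, huv.ne.symm, hu₁.ne, hu₁.ne.symm, hv₁.ne, hv₁.ne.symm] using this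
  have hcuv : c s(v, u) ≠ 0 := by
    obtain ⟨w, hw, hwv, hcw⟩ := exists_ne_of_mem_evenSpace hc.mem h
    have hwu : w = u := by
      by_contra hwu
      apply hcw
      have := congrFun h₁ s(v, w)
      simpa [triangle, hw, hwv, hwu, huv.ne, huv.ne.symm, hv₁.ne, hv₁.ne.symm] using this.symm
    exact hwu ▸ hcw
  have h₂ : c * triangle u v w₂ = c := by
    refine (hc.dichotomy _ (triangle_mem huv hv₂ hu₂.symm)).resolve_left fun h0 => hcuv ?_
    have := congrFun h0 s(v, u)
    simpa [triangle, Pi.single_apply, huv.ne, huv.ne.symm, hu₂.ne, hu₂.ne.symm, hv₂.ne, hv₂.ne.symm] using this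
  apply h
  have := congrFun h₂ s(v, w₁)
  simpa [triangle, hne, hu₁.ne, hu₁.ne.symm, hv₁.ne, hv₁.ne.symm, hv₂.ne, hv₂.ne.symm,
    huv.ne, huv.ne.symm] using this.symm

end EvenSpace

/-! ### Coloops under the Kelmans transformation of adjacent vertices -/

section Glue

variable {V : Type*} [DecidableEq V]

/-- The edge function that is prescribed at the edges of `u` and of `v`. -/
def glue (u v : V) (d : Sym2 V → ZMod 2) (p q : V → ZMod 2) (r : ZMod 2) : Sym2 V → ZMod 2 :=
  Sym2.lift ⟨fun x y => if x = y then 0 else if (x = u ∧ y = v) ∨ (x = v ∧ y = u) then r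
    else if x = u then p y else if y = u then p x else if x = v then q y
    else if y = v then q x else d s(x, y), by
      intro x y
      have := Sym2.eq_swap (a := x) (b := y)
      grind⟩

variable {u v : V} (d : Sym2 V → ZMod 2) (p q : V → ZMod 2) (r : ZMod 2)

theorem glue_uv (huv : u ≠ v) : glue u v d p q r s(u, v) = r := by simp [glue, huv]

theorem glue_u {w : V} (hu : w ≠ u) (hv : w ≠ v) : glue u v d p q r s(u, w) = p w := by
  simp [glue, hu.symm, hv]; grind

theorem glue_v (huv : u ≠ v) {w : V} (hu : w ≠ u) (hv : w ≠ v) :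
    glue u v d p q r s(v, w) = q w := by
  simp [glue, hu, hv.symm, huv.symm]

theorem glue_rest {x y : V} (hxu : x ≠ u) (hxv : x ≠ v) (hyu : y ≠ u) (hyv : y ≠ v)
    (hxy : x ≠ y) : glue u v d p q r s(x, y) = d s(x, y) := by
  simp [glue, *]

theorem glue_diag (x : V) : glue u v d p q r s(x, x) = 0 := by simp [glue]

theorem sum_eq_add_sum_erase [Fintype V] (huv : u ≠ v) (f : V → ZMod 2) :
    ∑ w, f w = f u + (f v + ∑ w ∈ (Finset.univ.erase u).erase v, f w) := by
  rw [Finset.add_sum_erase _ _ (Finset.mem_erase.2 ⟨huv.symm, Finset.mem_univ v⟩),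
    Finset.add_sum_erase _ _ (Finset.mem_univ u)]

/-- Evenness at `v` forces the value at `uv` to be the sum of `q`. Adding the parities of `d` at `u`
and `v` cancels `d s(u, v)`, so `p` and `q` have equal sums and evenness at `u` follows. At any
other vertex `w` only `p w + q w` matters. -/
theorem glue_mem [Fintype V] {G H : SimpleGraph V} (huv : H.Adj u v) {d : Sym2 V → ZMod 2}
    (hd : d ∈ evenSpace G) {p q : V → ZMod 2}
    (hp : ∀ w, w ≠ u → w ≠ v → p w ≠ 0 → H.Adj u w)
    (hq : ∀ w, w ≠ u → w ≠ v → q w ≠ 0 → H.Adj v w)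
    (hrest : ∀ x y, x ≠ u → x ≠ v → y ≠ u → y ≠ v → (G.Adj x y → H.Adj x y))
    (hpq : ∀ w, w ≠ u → w ≠ v → p w + q w = d s(u, w) + d s(v, w)) :
    glue u v d p q (∑ w ∈ (Finset.univ.erase u).erase v, q w) ∈ evenSpace H := by
  set r := ∑ w ∈ (Finset.univ.erase u).erase v, q w with hr
  have hne := huv.ne
  have mem : ∀ w ∈ (Finset.univ.erase u).erase v, w ≠ u ∧ w ≠ v := fun w hw => by
    simp only [Finset.mem_erase, Finset.mem_univ, and_true] at hw
    exact ⟨hw.2, hw.1⟩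
  have hsumq : ∑ w ∈ (Finset.univ.erase u).erase v, glue u v d p q r s(v, w) = r :=
    Finset.sum_congr rfl fun w hw => glue_v d p q r hne (mem w hw).1 (mem w hw).2
  have hsump : ∑ w ∈ (Finset.univ.erase u).erase v, glue u v d p q r s(u, w) =
      ∑ w ∈ (Finset.univ.erase u).erase v, p w :=
    Finset.sum_congr rfl fun w hw => glue_u d p q r (mem w hw).1 (mem w hw).2
  have hpqs : ∑ w ∈ (Finset.univ.erase u).erase v, p w + r =
      ∑ w ∈ (Finset.univ.erase u).erase v, d s(u, w) +
      ∑ w ∈ (Finset.univ.erase u).erase v, d s(v, w) := by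
    rw [hr, ← Finset.sum_add_distrib, ← Finset.sum_add_distrib]
    exact Finset.sum_congr rfl fun w hw => hpq w (mem w hw).1 (mem w hw).2
  refine ⟨fun e he => ?_, fun x => ?_⟩
  · induction e using Sym2.ind with | _ x y
    by_contra h
    apply he
    rw [SimpleGraph.mem_edgeSet]
    by_cases hxy : x = y
    · subst hxy; exact absurd (glue_diag d p q r x) h
    by_cases hxu : x = u
    · subst hxu
      by_cases hyv : y = v
      · subst hyv; exact huv
      · rw [glue_u d p q r (Ne.symm hxy) hyv] at h; exact hp y (Ne.symm hxy) hyv h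
    by_cases hyu : y = u
    · subst hyu
      by_cases hxv : x = v
      · subst hxv; exact huv.symm
      · rw [Sym2.eq_swap, glue_u d p q r hxy hxv] at h; exact (hp x hxy hxv h).symm
    by_cases hxv : x = v
    · subst hxv
      rw [glue_v d p q r hne hyu (Ne.symm hxy)] at h; exact hq y hyu (Ne.symm hxy) h
    by_cases hyv : y = v
    · subst hyv
      rw [Sym2.eq_swap, glue_v d p q r hne hxu hxv] at h; exact (hq x hxu hxv h).symm
    rw [glue_rest d p q r hxu hxv hyu hyv hxy] at h
    exact hrest x y hxu hxv hyu hyv (adj_of_mem_evenSpace hd h)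
  · by_cases hxu : x = u
    · subst hxu
      have h1 := hd.2 x
      have h2 := hd.2 v
      rw [sum_eq_add_sum_erase hne] at h1 h2 ⊢
      rw [glue_diag, glue_uv _ _ _ _ hne, hsump]
      rw [diag_of_mem_evenSpace hd] at h1 h2
      rw [Sym2.eq_swap] at h2
      generalize ∑ w ∈ (Finset.univ.erase x).erase v, p w = a at *
      generalize ∑ w ∈ (Finset.univ.erase x).erase v, d s(x, w) = a1 at *
      generalize ∑ w ∈ (Finset.univ.erase x).erase v, d s(v, w) = a2 at *
      generalize d s(x, v) = a3 at *
      clear_value r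
      clear hr hsumq hsump
      revert a r a1 a2 a3; decide
    by_cases hxv : x = v
    · subst hxv
      rw [sum_eq_add_sum_erase hne, glue_diag, Sym2.eq_swap, glue_uv _ _ _ _ hne, hsumq]
      simp [CharTwo.add_self_eq_zero]
    · have h1 := hd.2 x
      rw [sum_eq_add_sum_erase hne] at h1 ⊢
      rw [Sym2.eq_swap, glue_u _ _ _ _ hxu hxv, Sym2.eq_swap (a := x), glue_v _ _ _ _ hne hxu hxv,
        ← h1, ← add_assoc, ← add_assoc, hpq x hxu hxv, Sym2.eq_swap, Sym2.eq_swap (a := v)]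
      congr 1
      refine Finset.sum_congr rfl fun w hw => ?_
      by_cases hxw : x = w
      · subst hxw; rw [glue_diag, diag_of_mem_evenSpace hd]
      · exact glue_rest _ _ _ _ hxu hxv (mem w hw).1 (mem w hw).2 hxw

end Glue

/-! ### The correspondence of even edge sets of `G` and `G'` -/

/-- Two edge functions correspond to each other under the Kelmans transformation. -/
structure KelmansRel {V : Type*} (G : SimpleGraph V) (u v : V) (d d' : Sym2 V → ZMod 2) : Prop where
  rest : ∀ x y, x ≠ u → x ≠ v → y ≠ u → y ≠ v → d s(x, y) = d' s(x, y)
  add : ∀ w, w ≠ u → w ≠ v → d s(u, w) + d s(v, w) = d' s(u, w) + d' s(v, w)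
  common : ∀ w, w ≠ u → w ≠ v → G.Adj u w → G.Adj v w → d s(v, w) = d' s(v, w)

namespace KelmansRel

variable {V : Type*} {G G' : SimpleGraph V} {u v : V} {c c' d d' : Sym2 V → ZMod 2}

theorem sub (hc : KelmansRel G u v c c') (hd : KelmansRel G u v d d') :
    KelmansRel G u v (c - d) (c' - d') where
  rest x y h1 h2 h3 h4 := by simp [hc.rest x y h1 h2 h3 h4, hd.rest x y h1 h2 h3 h4]
  add w h1 h2 := by
    have e1 := hc.add w h1 h2
    have e2 := hd.add w h1 h2
    simp only [Pi.sub_apply]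
    linear_combination e1 - e2
  common w h1 h2 h3 h4 := by simp [hc.common w h1 h2 h3 h4, hd.common w h1 h2 h3 h4]

theorem apply_u_of_common (h : KelmansRel G u v d d') {w : V} (hu : w ≠ u)
    (hv : w ≠ v) (h1 : G.Adj u w) (h2 : G.Adj v w) : d' s(u, w) = d s(u, w) := by
  have e := h.add w hu hv
  rw [h.common w hu hv h1 h2] at e
  exact (add_right_cancel e).symm

variable [Fintype V]

theorem apply_v_eq_zero (hk : IsKelmans G G' u v) (hd' : d' ∈ evenSpace G') {w : V} (hu : w ≠ u)
    (hv : w ≠ v) (hw : ¬ (G.Adj u w ∧ G.Adj v w)) : d' s(v, w) = 0 :=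
  eq_zero_of_not_adj hd' fun h => hw ((hk.adj_v w hu hv).1 h)

theorem apply_u_of_not_common (hk : IsKelmans G G' u v) (hd' : d' ∈ evenSpace G')
    (h : KelmansRel G u v d d') {w : V} (hu : w ≠ u)
    (hv : w ≠ v) (hw : ¬ (G.Adj u w ∧ G.Adj v w)) : d' s(u, w) = d s(u, w) + d s(v, w) := by
  have e := h.add w hu hv
  rw [apply_v_eq_zero hk hd' hu hv hw] at e
  simpa using e.symm

/-- Edge functions in the even space are determined by their values away from `uv`. -/
theorem _root_.Tricyclic.eq_zero_of_apply_eq_zero {H : SimpleGraph V} (hd : d ∈ evenSpace H)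
    (hne : u ≠ v)
    (h1 : ∀ x y, x ≠ u → x ≠ v → y ≠ u → y ≠ v → d s(x, y) = 0)
    (h2 : ∀ w, w ≠ u → w ≠ v → d s(u, w) = 0) (h3 : ∀ w, w ≠ u → w ≠ v → d s(v, w) = 0) :
    d = 0 := by
  classical
  have huv : d s(u, v) = 0 := by
    by_contra h
    obtain ⟨w, hw, hw', hdw⟩ := exists_ne_of_mem_evenSpace hd h
    exact hdw (h2 w hw' hw)
  funext e
  induction e using Sym2.ind with | _ x y
  simp only [Pi.zero_apply]
  by_cases hxy : x = y
  · subst hxy; exact diag_of_mem_evenSpace hd x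
  by_cases hxu : x = u
  · subst hxu
    by_cases hyv : y = v
    · subst hyv; exact huv
    · exact h2 y (Ne.symm hxy) hyv
  by_cases hyu : y = u
  · subst hyu
    rw [Sym2.eq_swap]
    by_cases hxv : x = v
    · subst hxv; exact huv
    · exact h2 x hxy hxv
  by_cases hxv : x = v
  · subst hxv; exact h3 y hyu (Ne.symm hxy)
  by_cases hyv : y = v
  · subst hyv; rw [Sym2.eq_swap]; exact h3 x hxu hxv
  exact h1 x y hxu hxv hyu hyv

/-- Injectivity of the correspondence: at a common neighbour both values are prescribed, and at any
other vertex at least one of the two pairs is not an edge of `G`, so the sum determines both values.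
-/
theorem eq_zero_left (hne : u ≠ v) (hd : d ∈ evenSpace G) (h : KelmansRel G u v d 0) : d = 0 := by
  have key : ∀ w, w ≠ u → w ≠ v → d s(u, w) = 0 ∧ d s(v, w) = 0 := fun w hwu hwv => by
    have e := h.add w hwu hwv
    by_cases h1 : G.Adj u w
    · by_cases h2 : G.Adj v w
      · have e2 := h.common w hwu hwv h1 h2
        simp only [Pi.zero_apply, add_zero] at e e2
        rw [e2, add_zero] at e
        exact ⟨e, e2⟩
      · have e2 := eq_zero_of_not_adj hd h2
        simp only [Pi.zero_apply, add_zero] at e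
        rw [e2, add_zero] at e
        exact ⟨e, e2⟩
    · have e2 := eq_zero_of_not_adj hd h1
      simp only [Pi.zero_apply, add_zero] at e
      rw [e2, zero_add] at e
      exact ⟨e2, e⟩
  exact eq_zero_of_apply_eq_zero hd hne
    (fun x y a b e f => by simpa using h.rest x y a b e f) (fun w a b => (key w a b).1)
    fun w a b => (key w a b).2

/-- Both edges at a common neighbour keep their values, the edge at a private neighbour carries its
value along to `u`, and parity fixes the value at `uv`. -/
theorem exists_right (hk : IsKelmans G G' u v) (huv : G.Adj u v) (hd : d ∈ evenSpace G) :
    ∃ d' ∈ evenSpace G', KelmansRel G u v d d' := by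
  classical
  have hpq : ∀ w, (if G.Adj u w ∧ G.Adj v w then d s(u, w) else d s(u, w) + d s(v, w)) +
      (if G.Adj u w ∧ G.Adj v w then d s(v, w) else 0) = d s(u, w) + d s(v, w) := fun w => by
    split_ifs <;> simp
  refine ⟨_, glue_mem (hk.adj_uv.2 huv) hd
    (p := fun w => if G.Adj u w ∧ G.Adj v w then d s(u, w) else d s(u, w) + d s(v, w))
    (q := fun w => if G.Adj u w ∧ G.Adj v w then d s(v, w) else 0) ?_ ?_
    (fun x y a b e f => (hk.adj_rest x y a b e f).2) (fun w _ _ => hpq w),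
    ⟨fun x y a b e f => ?_, fun w a b => ?_, fun w a b h1 h2 => ?_⟩⟩
  · intro w hu hv hw
    rw [hk.adj_u w hu hv]
    by_contra! hcon
    simp [hcon.1, eq_zero_of_not_adj hd hcon.1, eq_zero_of_not_adj hd hcon.2] at hw
  · intro w hu hv hw
    rw [hk.adj_v w hu hv]
    by_contra hcon
    simp [hcon] at hw
  · by_cases hxy : x = y
    · subst hxy; rw [glue_diag, diag_of_mem_evenSpace hd]
    · rw [glue_rest _ _ _ _ a b e f hxy]
  · rw [glue_u _ _ _ _ a b, glue_v _ _ _ _ hk.ne a b, hpq]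
  · rw [glue_v _ _ _ _ hk.ne a b]; simp [h1, h2]

/-- The inverse of `exists_right`: the value at `uw` for a private neighbour `w` returns to the end
to which `w` was joined in `G`. -/
theorem exists_left (hk : IsKelmans G G' u v) (huv : G.Adj u v) (hd' : d' ∈ evenSpace G') :
    ∃ d ∈ evenSpace G, KelmansRel G u v d d' := by
  classical
  have hpq : ∀ w, w ≠ u → w ≠ v → (if G.Adj u w then d' s(u, w) else 0) +
      (if G.Adj v w then (if G.Adj u w then d' s(v, w) else d' s(u, w)) else 0) =
      d' s(u, w) + d' s(v, w) := fun w hu hv => by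
    by_cases h1 : G.Adj u w <;> by_cases h2 : G.Adj v w
    · simp [h1, h2]
    · simp [h1, h2, apply_v_eq_zero hk hd' hu hv (fun h => h2 h.2)]
    · simp [h1, h2, apply_v_eq_zero hk hd' hu hv (fun h => h1 h.1)]
    · have : ¬ G'.Adj u w := fun h => ((hk.adj_u w hu hv).1 h).elim h1 h2
      simp [h1, h2, apply_v_eq_zero hk hd' hu hv (fun h => h1 h.1), eq_zero_of_not_adj hd' this]
  refine ⟨_, glue_mem huv hd' (p := fun w => if G.Adj u w then d' s(u, w) else 0)
    (q := fun w => if G.Adj v w then (if G.Adj u w then d' s(v, w) else d' s(u, w)) else 0) ?_ ?_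
    (fun x y a b e f => (hk.adj_rest x y a b e f).1) hpq,
    ⟨fun x y a b e f => ?_, fun w a b => ?_, fun w a b h1 h2 => ?_⟩⟩
  · intro w hu hv hw
    by_contra hcon
    simp [hcon] at hw
  · intro w hu hv hw
    by_contra hcon
    simp [hcon] at hw
  · by_cases hxy : x = y
    · subst hxy; rw [glue_diag, diag_of_mem_evenSpace hd']
    · rw [glue_rest _ _ _ _ a b e f hxy]
  · rw [glue_u _ _ _ _ a b, glue_v _ _ _ _ hk.ne a b, hpq w a b]
  · rw [glue_v _ _ _ _ hk.ne a b]; simp [h1, h2]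

/-- Evenness at `v` requires a second edge `vw`, and in `G'` only common neighbours remain joined to
`v`. -/
theorem exists_common (hk : IsKelmans G G' u v) (hd' : d' ∈ evenSpace G')
    (h : KelmansRel G u v d d') (huv : d' s(u, v) ≠ 0) :
    ∃ w, w ≠ u ∧ w ≠ v ∧ G.Adj u w ∧ G.Adj v w ∧ d s(v, w) ≠ 0 := by
  rw [Sym2.eq_swap] at huv
  obtain ⟨w, hu, hv, hw⟩ := exists_ne_of_mem_evenSpace hd' huv
  have hadj := (hk.adj_v w hu hv).1 (adj_of_mem_evenSpace hd' hw)
  exact ⟨w, hu, hv, hadj.1, hadj.2, by rwa [h.common w hu hv hadj.1 hadj.2]⟩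

theorem mul_eq_zero (hk : IsKelmans G G' u v) (huv : G.Adj u v) (hc : IsColoop G c)
    (hd : d ∈ evenSpace G) (hc' : c' ∈ evenSpace G') (hd' : d' ∈ evenSpace G')
    (hcr : KelmansRel G u v c c') (hdr : KelmansRel G u v d d') (h : c * d = 0) :
    c' * d' = 0 := by
  classical
  have hcd : ∀ x y, c s(x, y) * d s(x, y) = 0 := fun x y => congrFun h s(x, y)
  have hU : ∀ w, w ≠ u → w ≠ v → c' s(u, w) * d' s(u, w) = 0 := fun w hu hv => by
    by_cases hw : G.Adj u w ∧ G.Adj v w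
    · rw [hcr.apply_u_of_common hu hv hw.1 hw.2, hdr.apply_u_of_common hu hv hw.1 hw.2, hcd]
    · rw [apply_u_of_not_common hk hc' hcr hu hv hw, apply_u_of_not_common hk hd' hdr hu hv hw]
      by_cases h1 : G.Adj u w
      · have h2 : ¬ G.Adj v w := fun h2 => hw ⟨h1, h2⟩
        rw [eq_zero_of_not_adj hc.mem h2, eq_zero_of_not_adj hd h2, add_zero, add_zero, hcd]
      · rw [eq_zero_of_not_adj hc.mem h1, eq_zero_of_not_adj hd h1, zero_add, zero_add, hcd]
  have hV : ∀ w, w ≠ u → w ≠ v → c' s(v, w) * d' s(v, w) = 0 := fun w hu hv => by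
    by_cases hw : G.Adj u w ∧ G.Adj v w
    · rw [← hcr.common w hu hv hw.1 hw.2, ← hdr.common w hu hv hw.1 hw.2, hcd]
    · rw [apply_v_eq_zero hk hc' hu hv hw, zero_mul]
  -- Only at `uv` could disjointness fail. Both sets would then use an edge from `v` to a common
  -- neighbour in `G`: the same edge contradicts `h`, and different ones give two triangles on `uv`,
  -- excluded for a coloop.
  have hUV : c' s(u, v) * d' s(u, v) = 0 := by
    by_contra hcon
    obtain ⟨w₁, -, -, hu₁, hv₁, hw₁⟩ := hcr.exists_common hk hc' (left_ne_zero_of_mul hcon)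
    obtain ⟨w₂, -, -, hu₂, hv₂, hw₂⟩ := hdr.exists_common hk hd' (right_ne_zero_of_mul hcon)
    by_cases hne : w₁ = w₂
    · subst hne; exact mul_ne_zero hw₁ hw₂ (hcd _ _)
    · exact hw₁ (hc.eq_zero_of_diamond huv hu₁ hv₁ hu₂ hv₂ hne)
  funext e
  induction e using Sym2.ind with | _ x y
  simp only [Pi.mul_apply, Pi.zero_apply]
  by_cases hxy : x = y
  · subst hxy; rw [diag_of_mem_evenSpace hd', mul_zero]
  by_cases hxu : x = u
  · subst hxu
    by_cases hyv : y = v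
    · subst hyv; exact hUV
    · exact hU y (Ne.symm hxy) hyv
  by_cases hyu : y = u
  · subst hyu
    rw [Sym2.eq_swap]
    by_cases hxv : x = v
    · subst hxv; exact hUV
    · exact hU x hxy hxv
  by_cases hxv : x = v
  · subst hxv; exact hV y hyu (Ne.symm hxy)
  by_cases hyv : y = v
  · subst hyv; rw [Sym2.eq_swap]; exact hV x hxu hxv
  rw [← hcr.rest x y hxu hxv hyu hyv, ← hdr.rest x y hxu hxv hyu hyv, hcd]

theorem exists_isColoop (hk : IsKelmans G G' u v) (huv : G.Adj u v) (hc : IsColoop G c) :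
    ∃ c', IsColoop G' c' ∧ KelmansRel G u v c c' := by
  obtain ⟨c', hc', hr⟩ := exists_right hk huv hc.mem
  refine ⟨c', ⟨hc', ?_, fun d' hd' => ?_⟩, hr⟩
  · rintro rfl
    exact hc.ne_zero (hr.eq_zero_left hk.ne hc.mem)
  · obtain ⟨d, hd, hdr⟩ := exists_left hk huv hd'
    rcases hc.dichotomy d hd with h | h
    · exact .inl (mul_eq_zero hk huv hc hd hc' hd' hr hdr h)
    · right
      -- If `d` contains `c`, then `c - d` avoids `c`, which reduces to the disjoint case.
      have := mul_eq_zero hk huv hc (Submodule.sub_mem _ hc.mem hd) hc'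
        (Submodule.sub_mem _ hc' hd') hr (hr.sub hdr) (by
          rw [mul_sub, h, sub_eq_zero]
          funext e; exact zmod_two_mul_self _)
      rw [mul_sub, sub_eq_zero] at this
      rw [← this]
      funext e; exact zmod_two_mul_self _

end KelmansRel

/-- A lost edge `vw` is replaced by the path `v`, `u`, `w`; this is where adjacency of `u` and `v`
enters. -/
theorem IsKelmans.connected {V : Type*} {G G' : SimpleGraph V} {u v : V}
    (hk : IsKelmans G G' u v) (huv : G.Adj u v) (hG : G.Connected) :
    G'.Connected := by
  have := hG.nonempty
  have huv' := hk.adj_uv.2 huv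
  have step : ∀ x y, G.Adj x y → G'.Reachable x y := by
    have hv : ∀ w, w ≠ u → w ≠ v → G.Adj v w → G'.Reachable v w := fun w hu hv h =>
      huv'.symm.reachable.trans ((hk.adj_u w hu hv).2 (.inr h)).reachable
    have hu : ∀ w, w ≠ u → w ≠ v → G.Adj u w → G'.Reachable u w := fun w hu hv h =>
      ((hk.adj_u w hu hv).2 (.inl h)).reachable
    intro x y h
    by_cases hxu : x = u
    · subst hxu
      by_cases hyv : y = v
      · subst hyv; exact huv'.reachable
      · exact hu y h.ne.symm hyv h
    by_cases hyu : y = u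
    · subst hyu
      by_cases hxv : x = v
      · subst hxv; exact huv'.symm.reachable
      · exact (hu x h.ne hxv h.symm).symm
    by_cases hxv : x = v
    · subst hxv; exact hv y hyu h.ne.symm h
    by_cases hyv : y = v
    · subst hyv; exact (hv x hxu hxv h.symm).symm
    exact ((hk.adj_rest x y hxu hxv hyu hyv).2 h).reachable
  refine ⟨fun x y => ?_⟩
  obtain ⟨p⟩ := hG.preconnected x y
  induction p with
  | nil => exact .refl _
  | cons h _ ih => exact (step _ _ h).trans ih

namespace IsKelmans

variable {V : Type*} [Fintype V] {G G' : SimpleGraph V} {u v : V}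

theorem exists_isColoop (hk : IsKelmans G G' u v) (huv : G.Adj u v) (h : ∃ c, IsColoop G c) :
    ∃ c, IsColoop G' c := by
  obtain ⟨c, hc⟩ := h
  obtain ⟨c', hc', -⟩ := KelmansRel.exists_isColoop hk huv hc
  exact ⟨c', hc'⟩

theorem exists_two_isColoop (hk : IsKelmans G G' u v) (huv : G.Adj u v)
    (h : ∃ c₁ c₂, IsColoop G c₁ ∧ IsColoop G c₂ ∧ c₁ ≠ c₂) :
    ∃ c₁ c₂, IsColoop G' c₁ ∧ IsColoop G' c₂ ∧ c₁ ≠ c₂ := by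
  obtain ⟨c₁, c₂, h₁, h₂, hne⟩ := h
  obtain ⟨c₁', h₁', r₁⟩ := KelmansRel.exists_isColoop hk huv h₁
  obtain ⟨c₂', h₂', r₂⟩ := KelmansRel.exists_isColoop hk huv h₂
  refine ⟨c₁', c₂', h₁', h₂', ?_⟩
  rintro rfl
  have := r₁.sub r₂
  rw [sub_self] at this
  exact hne (sub_eq_zero.1 (this.eq_zero_left hk.ne (Submodule.sub_mem _ h₁.mem h₂.mem)))

theorem isTricyclic (hk : IsKelmans G G' u v) (huv : G.Adj u v) (hG : IsTricyclic G) :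
    IsTricyclic G' :=
  ⟨hk.connected huv hG.1, by rw [hk.ncard_edgeSet, hG.2]⟩

end IsKelmans

/-- The Kelmans transformation of `G` that moves edges from `v` to `u`. -/
def kelmans {V : Type*} (G : SimpleGraph V) (u v : V) : SimpleGraph V :=
  SimpleGraph.fromRel fun x y =>
    (x = u ∧ y = v ∧ G.Adj u v) ∨ (x = u ∧ y ≠ u ∧ y ≠ v ∧ (G.Adj u y ∨ G.Adj v y)) ∨
    (x = v ∧ y ≠ u ∧ y ≠ v ∧ G.Adj u y ∧ G.Adj v y) ∨
    (x ≠ u ∧ x ≠ v ∧ y ≠ u ∧ y ≠ v ∧ G.Adj x y)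

theorem isKelmans_kelmans {V : Type*} (G : SimpleGraph V) {u v : V} (huv : u ≠ v) :
    IsKelmans G (kelmans G u v) u v where
  ne := huv
  adj_uv := by simp [kelmans, huv, huv.symm]
  adj_u w h1 h2 := by simp [kelmans, huv, h1, h2, h1.symm]
  adj_v w h1 h2 := by simp [kelmans, huv.symm, h1, h2, h2.symm]
  adj_rest x y h1 h2 h3 h4 := by
    simp only [kelmans, fromRel_adj, h1, h2, h3, h4, false_and, false_or, ne_eq, not_false_eq_true,
      true_and, G.adj_comm y x, or_self]
    exact ⟨fun h => h.2, fun h => ⟨h.ne, h⟩⟩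

/-- A connected graph whose vertex `u` of maximum degree is not adjacent to all other vertices
admits an essential Kelmans transformation of adjacent vertices. -/
theorem exists_isKelmans_of_not_dominating {V : Type*} [Fintype V] [DecidableEq V]
    {G : SimpleGraph V} (hG : G.Connected) {u : V}
    (hu : ∀ v, realDegree G v ≤ realDegree G u) (hd : ∃ x, x ≠ u ∧ ¬ G.Adj u x) :
    ∃ (G' : SimpleGraph V) (v : V), IsKelmans G G' u v ∧ G.Adj u v ∧ SLEE G < SLEE G' := by
  obtain ⟨x, hxu, hx⟩ := hd
  obtain ⟨p⟩ := hG.preconnected u x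
  -- Where the walk leaves the closed neighbourhood of `u`, the vertex `w` is a private neighbour of
  -- `v`.
  obtain ⟨⟨⟨v, w⟩, hvw⟩, -, h1, h2⟩ := p.exists_boundary_dart {y | y = u ∨ G.Adj u y} (.inl rfl)
    (by simp [hxu, hx])
  simp only [Set.mem_ofPred_eq, not_or] at h1 h2
  have huv : G.Adj u v := h1.resolve_left fun h => h2.2 (h ▸ hvw)
  -- Otherwise `v` has all other neighbours of `u` and also `w`, so its degree exceeds the maximum.
  have ha : ∃ a, G.Adj u a ∧ ¬ G.Adj v a ∧ a ≠ v := by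
    by_contra! hcon
    have hlt : realDegree G u < realDegree G v := by
      unfold realDegree
      rw [← Finset.add_sum_erase _ _ (Finset.mem_univ u),
        ← Finset.add_sum_erase _ _ (Finset.mem_erase.2 ⟨huv.ne.symm, Finset.mem_univ v⟩),
        ← Finset.add_sum_erase _ _ (Finset.mem_univ u),
        ← Finset.add_sum_erase _ _ (Finset.mem_erase.2 ⟨huv.ne.symm, Finset.mem_univ v⟩)]
      simp only [adjInd_self, adjInd_comm _ v u]
      have : ∑ y ∈ (Finset.univ.erase u).erase v, adjInd G u y <
          ∑ y ∈ (Finset.univ.erase u).erase v, adjInd G v y := by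
        refine Finset.sum_lt_sum (fun y hy => ?_) ⟨w, by simp [h2.1, hvw.ne.symm], ?_⟩
        · simp only [Finset.mem_erase, Finset.mem_univ, and_true] at hy
          by_cases hy' : G.Adj u y
          · rw [adjInd_of_adj hy']
            by_cases hy'' : G.Adj v y
            · rw [adjInd_of_adj hy'']
            · exact absurd (hcon y hy' hy'') hy.1
          · rw [adjInd_of_not_adj hy']; exact adjInd_nonneg _ _ _
        · rw [adjInd_of_adj hvw, adjInd_of_not_adj h2.2]; norm_num
      linarith
    exact absurd (hu v) (not_le.2 hlt)
  obtain ⟨a, hua, hva, hav⟩ := ha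
  have hk := isKelmans_kelmans G huv.ne
  exact ⟨_, v, hk, huv, hk.SLEE_lt hua hva hav hvw h2.2 h2.1⟩

/-! ### Circuits: the minimal even edge sets -/

section EdgeFunctions

variable {V : Type*} {G : SimpleGraph V}

theorem mul_self_fun (c : Sym2 V → ZMod 2) : c * c = c := funext fun _ => zmod_two_mul_self _

open scoped Classical in
/-- The indicator function of a set of edges. -/
noncomputable def edgeInd (s : Set (Sym2 V)) : Sym2 V → ZMod 2 := fun e => if e ∈ s then 1 else 0

theorem edgeInd_ne_zero {s : Set (Sym2 V)} {e : Sym2 V} : edgeInd s e ≠ 0 ↔ e ∈ s := by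
  unfold edgeInd; split_ifs <;> simp_all

theorem ncard_edges_at_of_mem_cycleEdgeSets {s : Set (Sym2 V)} (hs : s ∈ cycleEdgeSets G) {x y : V}
    (h : s(x, y) ∈ s) : {w | s(x, w) ∈ s}.ncard = 2 := by
  obtain ⟨v, p, hp, rfl⟩ := hs
  rw [← hp.ncard_neighborSet_toSubgraph_eq_two (p.fst_mem_support_of_mem_edges h)]
  congr 1
  ext w
  simp [Subgraph.mem_neighborSet, Walk.adj_toSubgraph_iff_mem_edges]

/-- The sum of a symmetric function with zero diagonal over a square vanishes in characteristic
two. -/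
theorem sum_square_eq_zero (S : Finset V) {d : Sym2 V → ZMod 2} (hd : ∀ x, d s(x, x) = 0) :
    ∑ x ∈ S, ∑ y ∈ S, d s(x, y) = 0 := by
  rw [← Finset.sum_product']
  refine Finset.sum_involution (fun p _ => (p.2, p.1)) ?_ ?_ ?_ ?_
  · rintro ⟨x, y⟩ -
    simp only [Sym2.eq_swap (a := y) (b := x)]
    exact CharTwo.add_self_eq_zero _
  · rintro ⟨x, y⟩ - h heq
    simp only [Prod.mk.injEq] at heq
    exact h (by simp [heq.1, hd])
  · rintro ⟨x, y⟩ h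
    simpa [and_comm] using h
  · simp

theorem mul_sum_of_mem {T : Finset (Sym2 V → ZMod 2)}
    (hT : ∀ c ∈ T, ∀ c' ∈ T, c ≠ c' → c * c' = 0) {c : Sym2 V → ZMod 2} (hc : c ∈ T) :
    c * ∑ c' ∈ T, c' = c := by
  rw [Finset.mul_sum, Finset.sum_eq_single c (fun c' hc' hne => hT c hc c' hc' hne.symm)
    (fun h => absurd hc h), mul_self_fun]

theorem edgeInd_ne_zero_of_mem {s : Set (Sym2 V)} (hs : s ∈ cycleEdgeSets G) : edgeInd s ≠ 0 := by
  obtain ⟨v, p, hp, rfl⟩ := hs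
  intro h
  have hne : p.edges ≠ [] := by
    cases p with
    | nil => exact absurd rfl hp.ne_nil
    | cons h p => simp
  obtain ⟨e, he⟩ := List.exists_mem_of_ne_nil _ hne
  exact edgeInd_ne_zero.2 (Walk.mem_edgeSet.2 he) (congrFun h e)

end EdgeFunctions

section Circuit

variable {V : Type*} [Fintype V] {G : SimpleGraph V}

/-- A minimal nonempty even edge set. -/
structure IsCircuit (G : SimpleGraph V) (c : Sym2 V → ZMod 2) : Prop where
  mem : c ∈ evenSpace G
  ne_zero : c ≠ 0
  minimal : ∀ d ∈ evenSpace G, d ≠ 0 → c * d = d → d = c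

theorem ncard_support_lt {c d : Sym2 V → ZMod 2} (h : c * d = d) (hne : d ≠ c) :
    {e | d e ≠ 0}.ncard < {e | c e ≠ 0}.ncard := by
  have hle : ∀ e, d e ≠ 0 → c e ≠ 0 := fun e he hc => he (by
    rw [← h, Pi.mul_apply, hc, zero_mul])
  refine Set.ncard_lt_ncard ⟨fun e he => hle e he, fun hsub => hne ?_⟩ (Set.toFinite _)
  funext e
  by_cases he : c e = 0
  · rw [he]; by_contra hd; exact hle e hd he
  · rw [zmod_two_eq_one he, zmod_two_eq_one (hsub he)]

theorem exists_isCircuit_le {d : Sym2 V → ZMod 2} (hd : d ∈ evenSpace G) (hd0 : d ≠ 0) :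
    ∃ c, IsCircuit G c ∧ d * c = c := by
  obtain ⟨c, ⟨hc, hc0, hdc⟩, hmin⟩ := Set.exists_min_image
    {c | c ∈ evenSpace G ∧ c ≠ 0 ∧ d * c = c} (fun c => {e | c e ≠ 0}.ncard) (Set.toFinite _)
    ⟨d, hd, hd0, mul_self_fun d⟩
  refine ⟨c, ⟨hc, hc0, fun d' hd' hd'0 h => ?_⟩, hdc⟩
  by_contra hne
  exact absurd (hmin d' ⟨hd', hd'0, by rw [← h, ← mul_assoc, hdc]⟩)
    (not_le.2 (ncard_support_lt h hne))

/-- Every even edge set is a disjoint union of circuits. -/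
theorem exists_sum_isCircuit {d : Sym2 V → ZMod 2} (hd : d ∈ evenSpace G) :
    ∃ T : Finset (Sym2 V → ZMod 2), (∀ c ∈ T, IsCircuit G c) ∧
      (∀ c ∈ T, ∀ c' ∈ T, c ≠ c' → c * c' = 0) ∧ ∑ c ∈ T, c = d := by
  classical
  induction hn : {e | d e ≠ 0}.ncard using Nat.strong_induction_on generalizing d with
  | _ n ih
  by_cases hd0 : d = 0
  · exact ⟨∅, by simp, by simp, by simp [hd0]⟩
  obtain ⟨c, hc, hdc⟩ := exists_isCircuit_le hd hd0
  -- Induction on the size: splitting off a circuit `c` inside `d` leaves the smaller even set `d -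
  -- c`, which is disjoint from `c`.
  have hsub : d * (d - c) = d - c := by rw [mul_sub, mul_self_fun, hdc]
  obtain ⟨T, hT, hT', hsum⟩ := ih _ (hn ▸ ncard_support_lt hsub
    (fun h => hc.ne_zero (by simpa using h))) (Submodule.sub_mem _ hd hc.mem) rfl
  have hdisj : ∀ c' ∈ T, c * c' = 0 := fun c' hc' => by
    have h1 : c' * (d - c) = c' := hsum ▸ mul_sum_of_mem hT' hc'
    rw [← h1, mul_left_comm, mul_sub, mul_self_fun, mul_comm c d, hdc, sub_self, mul_zero]
  have hcT : c ∉ T := fun h => hc.ne_zero (by rw [← mul_self_fun c]; exact hdisj c h)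
  refine ⟨insert c T, ?_, ?_, by rw [Finset.sum_insert hcT, hsum]; ring⟩
  · intro c' hc'
    rcases Finset.mem_insert.1 hc' with rfl | h
    exacts [hc, hT _ h]
  · intro a ha b hb hab
    rcases Finset.mem_insert.1 ha with rfl | ha₁ <;> rcases Finset.mem_insert.1 hb with rfl | hb
    · exact absurd rfl hab
    · exact hdisj b hb
    · rw [mul_comm]; exact hdisj a ha₁
    · exact hT' a ha₁ b hb hab

theorem IsCircuit.isColoop {c : Sym2 V → ZMod 2} (hc : IsCircuit G c)
    (h : ∀ c', IsCircuit G c' → c' ≠ c → c * c' = 0) : IsColoop G c where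
  mem := hc.mem
  ne_zero := hc.ne_zero
  dichotomy d hd := by
    obtain ⟨T, hT, hT', rfl⟩ := exists_sum_isCircuit hd
    by_cases hcT : c ∈ T
    · exact .inr (mul_sum_of_mem hT' hcT)
    · left
      rw [Finset.mul_sum]
      exact Finset.sum_eq_zero fun c' hc' => h c' (hT c' hc') fun h' => hcT (h' ▸ hc')

/-! ### Cycles and circuits -/

theorem edgeInd_mem {s : Set (Sym2 V)} (hs : s ∈ cycleEdgeSets G) : edgeInd s ∈ evenSpace G := by
  classical
  refine ⟨fun e he => ?_, fun x => ?_⟩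
  · obtain ⟨v, p, hp, rfl⟩ := hs
    by_contra h
    exact he (p.edges_subset_edgeSet (edgeInd_ne_zero.1 h))
  · by_cases hx : ∃ y, s(x, y) ∈ s
    · obtain ⟨y, hy⟩ := hx
      have h2 := ncard_edges_at_of_mem_cycleEdgeSets hs hy
      have h3 : ∑ w, edgeInd s s(x, w) = (({w | s(x, w) ∈ s} : Set V).ncard : ZMod 2) := by
        rw [Set.ncard_eq_toFinset_card']
        simp [edgeInd]
      rw [h3, h2]; rfl
    · push Not at hx
      exact Finset.sum_eq_zero fun w _ => not_not.1 (mt edgeInd_ne_zero.1 (hx w))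

/-- In a forest an edge `ab` of `d` is a bridge. The parities summed over the side `S` of `a` count
the edges inside `S` twice and `ab` once, which is odd. -/
theorem not_isAcyclic_of_mem_evenSpace {d : Sym2 V → ZMod 2} (hd : d ∈ evenSpace G) (hd0 : d ≠ 0) :
    ¬ (SimpleGraph.fromEdgeSet {e | d e ≠ 0}).IsAcyclic := by
  classical
  intro hac
  obtain ⟨e, he⟩ := Function.ne_iff.1 hd0
  induction e using Sym2.ind with | _ a b
  simp only [Pi.zero_apply] at he
  set H := SimpleGraph.fromEdgeSet {e | d e ≠ 0} with hH
  have hne : a ≠ b := (adj_of_mem_evenSpace hd he).ne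
  have hab : s(a, b) ∈ H.edgeSet := (SimpleGraph.fromEdgeSet_adj _).2 ⟨he, hne⟩
  have hbr := SimpleGraph.isBridge_iff.1 (SimpleGraph.isAcyclic_iff_forall_isBridge.1 hac hab)
  set S := Finset.univ.filter fun x => (H.deleteEdges {s(a, b)}).Reachable a x with hS
  have haS : a ∈ S := by simp [hS]
  have hbS : b ∉ S := by simpa [hS] using hbr
  have key : ∀ x ∈ S, ∀ y ∉ S, d s(x, y) ≠ 0 → x = a ∧ y = b := by
    intro x hx y hy hxy
    simp only [hS, Finset.mem_filter, Finset.mem_univ, true_and] at hx hy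
    by_contra hcon
    have hadj : H.Adj x y :=
      (SimpleGraph.fromEdgeSet_adj _).2 ⟨hxy, (adj_of_mem_evenSpace hd hxy).ne⟩
    by_cases hee : s(x, y) = s(a, b)
    · rcases Sym2.eq_iff.1 hee with h | ⟨h, h'⟩
      · exact hcon h
      · exact hbr (h ▸ hx)
    · exact hy (hx.trans (SimpleGraph.Adj.reachable
        (SimpleGraph.deleteEdges_adj.2 ⟨hadj, by simpa using hee⟩)))
  have h0 : ∑ x ∈ S, ∑ y, d s(x, y) = 0 := Finset.sum_eq_zero fun x _ => hd.2 x
  have h1 : ∑ x ∈ S, ∑ y, d s(x, y) =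
      ∑ x ∈ S, ∑ y ∈ S, d s(x, y) + ∑ x ∈ S, ∑ y ∈ Sᶜ, d s(x, y) := by
    rw [← Finset.sum_add_distrib]
    exact Finset.sum_congr rfl fun x _ => (Finset.sum_add_sum_compl S _).symm
  have h2 : ∑ x ∈ S, ∑ y ∈ Sᶜ, d s(x, y) = d s(a, b) := by
    rw [Finset.sum_eq_single a, Finset.sum_eq_single b]
    · intro y hy hyb
      by_contra h
      exact hyb (key a haS y (Finset.mem_compl.1 hy) h).2
    · intro h; exact absurd (Finset.mem_compl.2 hbS) h
    · intro x hx hxa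
      refine Finset.sum_eq_zero fun y hy => ?_
      by_contra h
      exact hxa (key x hx y (Finset.mem_compl.1 hy) h).1
    · intro h; exact absurd haS h
  rw [h1, sum_square_eq_zero S (diag_of_mem_evenSpace hd), zero_add, h2] at h0
  exact he h0

/-- The support contains a cycle, whose indicator is a nonzero even set; minimality makes them
equal. -/
theorem IsCircuit.support_mem {c : Sym2 V → ZMod 2} (hc : IsCircuit G c) :
    {e | c e ≠ 0} ∈ cycleEdgeSets G := by
  have h := not_isAcyclic_of_mem_evenSpace hc.mem hc.ne_zero
  unfold SimpleGraph.IsAcyclic at h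
  push Not at h
  obtain ⟨v, p, hp⟩ := h
  have hle : SimpleGraph.fromEdgeSet {e | c e ≠ 0} ≤ G := by
    intro x y hxy
    exact adj_of_mem_evenSpace hc.mem ((SimpleGraph.fromEdgeSet_adj _).1 hxy).1
  have hcyc : p.edgeSet ∈ cycleEdgeSets G :=
    ⟨v, p.mapLe hle, hp.mapLe hle, by ext e; simp⟩
  have heq := hc.minimal _ (edgeInd_mem hcyc) (edgeInd_ne_zero_of_mem hcyc) (by
    funext e
    by_cases he : e ∈ p.edgeSet
    · have h1 : e ∈ (SimpleGraph.fromEdgeSet {e | c e ≠ 0}).edgeSet := p.edges_subset_edgeSet he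
      rw [SimpleGraph.edgeSet_fromEdgeSet] at h1
      rw [Pi.mul_apply, zmod_two_eq_one h1.1, one_mul]
    · rw [Pi.mul_apply, not_not.1 (mt edgeInd_ne_zero.1 he), mul_zero])
  convert hcyc using 1
  ext e
  change c e ≠ 0 ↔ _
  rw [← congrFun heq e]
  exact edgeInd_ne_zero

theorem ncard_isCircuit_le_numCycles : {c | IsCircuit G c}.ncard ≤ numCycles G := by
  refine Set.ncard_le_ncard_of_injOn (fun c => {e | c e ≠ 0}) (fun c hc => hc.support_mem)
    (fun c _ c' _ h => ?_) (Set.toFinite _)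
  funext e
  have he : c e ≠ 0 ↔ c' e ≠ 0 := by simpa using Set.ext_iff.1 h e
  by_cases h0 : c e = 0
  · rw [h0]; by_contra h1; exact he.2 (Ne.symm h1) h0
  · rw [zmod_two_eq_one h0, zmod_two_eq_one (he.1 h0)]

/-! ### The dimension of the cycle space -/

open scoped Classical in
/-- The edge function on all pairs that extends an edge function of `G` by zero. -/
noncomputable def extendEdges (G : SimpleGraph V) :
    (G.edgeSet → ZMod 2) →ₗ[ZMod 2] (Sym2 V → ZMod 2) where
  toFun f e := if h : e ∈ G.edgeSet then f ⟨e, h⟩ else 0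
  map_add' f g := by funext e; by_cases h : e ∈ G.edgeSet <;> simp [h]
  map_smul' a f := by funext e; by_cases h : e ∈ G.edgeSet <;> simp [h]

/-- The parities at the vertices other than `v₀`. -/
def boundary (v₀ : V) : (Sym2 V → ZMod 2) →ₗ[ZMod 2] ({v // v ≠ v₀} → ZMod 2) where
  toFun d v := ∑ w, d s(v.1, w)
  map_add' f g := by funext v; simp [Finset.sum_add_distrib]
  map_smul' a f := by funext v; simp [Finset.mul_sum]

/-- The n + 2 edge variables satisfy n - 1 parity conditions, which leaves dimension at least 3. The
condition at `v₀` is omitted because all parities add up to zero. -/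
theorem IsTricyclic.eight_le_card (hG : IsTricyclic G) : 8 ≤ Nat.card (evenSpace G) := by
  classical
  obtain ⟨v₀⟩ := hG.1.nonempty
  set φ := (boundary v₀).comp (extendEdges G) with hφ
  have hdim := φ.finrank_range_add_finrank_ker
  have hrange : Module.finrank (ZMod 2) φ.range ≤ Fintype.card V - 1 := by
    refine (Submodule.finrank_le _).trans ?_
    rw [Module.finrank_fintype_fun_eq_card, Fintype.card_subtype_compl]
    simp
  have hcard : 0 < Fintype.card V := Fintype.card_pos_iff.2 ⟨v₀⟩
  rw [Module.finrank_fintype_fun_eq_card, ← Set.toFinset_card, ← Set.ncard_eq_toFinset_card',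
    hG.2] at hdim
  have hker : 3 ≤ Module.finrank (ZMod 2) φ.ker := by omega
  have hle : 8 ≤ Nat.card φ.ker := by
    rw [Nat.card_eq_fintype_card, Module.card_eq_pow_finrank (K := ZMod 2), ZMod.card]
    calc 8 = 2 ^ 3 := by norm_num
      _ ≤ _ := Nat.pow_le_pow_right (by norm_num) hker
  have hmem : ∀ f : φ.ker, extendEdges G f.1 ∈ evenSpace G := by
    rintro ⟨f, hf⟩
    have hsupp : ∀ e, e ∉ G.edgeSet → extendEdges G f e = 0 := fun e he => by
      simp [extendEdges, he]
    have hb : ∀ v, v ≠ v₀ → ∑ w, extendEdges G f s(v, w) = 0 := fun v hv =>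
      congrFun (LinearMap.mem_ker.1 hf) ⟨v, hv⟩
    refine ⟨hsupp, fun v => ?_⟩
    by_cases hv : v = v₀
    · subst hv
      have h := sum_square_eq_zero Finset.univ (d := extendEdges G f)
        (fun x => hsupp _ (G.loopless.irrefl x))
      rwa [Finset.sum_eq_single v (fun x _ hx => hb x hx) (by simp)] at h
    · exact hb v hv
  refine hle.trans (Nat.card_le_card_of_injective (fun f => ⟨_, hmem f⟩) fun f g hfg => ?_)
  ext e
  have := congrFun (congrArg Subtype.val hfg) e.1
  simpa [extendEdges] using this

/-! ### Few cycles force coloops -/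

-- Each even set yields a family of disjoint circuits, and different even sets yield different
-- families because the sum of a family recovers the set.
open scoped Classical in
theorem eight_le_card_families (hG : IsTricyclic G) :
    ∃ F : Finset (Finset (Sym2 V → ZMod 2)), 8 ≤ F.card ∧ ∀ T ∈ F,
      (∀ c ∈ T, IsCircuit G c) ∧ (∀ c ∈ T, ∀ c' ∈ T, c ≠ c' → c * c' = 0) := by
  choose T hT hT' hsum using fun d : evenSpace G => exists_sum_isCircuit d.2
  have hinj : Function.Injective T := fun d d' h => by
    ext1; rw [← hsum d, ← hsum d', h]
  refine ⟨Finset.univ.image T, ?_, ?_⟩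
  · rw [Finset.card_image_of_injective _ hinj, Finset.card_univ, ← Nat.card_eq_fintype_card]
    exact hG.eight_le_card
  · intro S hS
    obtain ⟨d, -, rfl⟩ := Finset.mem_image.1 hS
    exact ⟨hT d, hT' d⟩

theorem exists_two_isColoop_of_numCycles_le (hG : IsTricyclic G) (h : numCycles G ≤ 3) :
    ∃ c₁ c₂, IsColoop G c₁ ∧ IsColoop G c₂ ∧ c₁ ≠ c₂ := by
  classical
  obtain ⟨F, hF, hF'⟩ := eight_le_card_families hG
  set C := (Set.toFinite {c | IsCircuit G c}).toFinset with hC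
  have hmemC : ∀ c, c ∈ C ↔ IsCircuit G c := fun c => by simp [hC]
  have hCcard : C.card ≤ 3 := by
    rw [hC, ← Set.ncard_eq_toFinset_card]
    exact ncard_isCircuit_le_numCycles.trans h
  have hsub : F ⊆ C.powerset := fun T hT =>
    Finset.mem_powerset.2 fun c hc => (hmemC c).2 ((hF' T hT).1 c hc)
  have hpow : C.powerset.card ≤ 8 := by
    rw [Finset.card_powerset]
    calc 2 ^ C.card ≤ 2 ^ 3 := Nat.pow_le_pow_right (by norm_num) hCcard
      _ = 8 := by norm_num
  -- Three circuits have only eight subfamilies, so all of them occur. In particular `C` itself is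
  -- pairwise disjoint, and every circuit is a coloop.
  have hFC := Finset.eq_of_subset_of_card_le hsub (hpow.trans hF)
  have hCF : C ∈ F := hFC ▸ Finset.mem_powerset_self C
  have hcol : ∀ c ∈ C, IsColoop G c := fun c hc =>
    ((hmemC c).1 hc).isColoop fun c' hc' hne => (hF' C hCF).2 c hc c' ((hmemC c').2 hc') hne.symm
  have h1 : 1 < C.card := by
    by_contra hlt
    have : C.powerset.card ≤ 2 := by
      rw [Finset.card_powerset]
      calc 2 ^ C.card ≤ 2 ^ 1 := Nat.pow_le_pow_right (by norm_num) (by omega)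
        _ = 2 := by norm_num
    have := Finset.card_le_card hsub
    omega
  obtain ⟨c₁, h₁, c₂, h₂, hne⟩ := Finset.one_lt_card.1 h1
  exact ⟨c₁, c₂, hcol c₁ h₁, hcol c₂ h₂, hne⟩

/-- If a circuit meets another one, it meets at least two others. -/
theorem IsCircuit.exists_second {c c₁ : Sym2 V → ZMod 2} (hc : IsCircuit G c)
    (hc₁ : IsCircuit G c₁) (hne : c₁ ≠ c) (hmul : c * c₁ ≠ 0) :
    ∃ c₂, IsCircuit G c₂ ∧ c₂ ≠ c ∧ c₂ ≠ c₁ ∧ c * c₂ ≠ 0 := by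
  obtain ⟨T, hT, hT', hsum⟩ := exists_sum_isCircuit (Submodule.sub_mem _ hc.mem hc₁.mem)
  have hcT : c ∉ T := fun h => hmul (by
    have := mul_sum_of_mem hT' h
    rwa [hsum, mul_sub, mul_self_fun, sub_eq_self] at this)
  have hcT₁ : c₁ ∉ T := fun h => by
    have h1 := mul_sum_of_mem hT' h
    rw [hsum, mul_sub, mul_self_fun, mul_comm c₁ c, sub_eq_iff_eq_add] at h1
    apply hmul
    rw [h1]
    funext e; exact CharTwo.add_self_eq_zero _
  -- Such an edge lies in `c - c₁`, hence in some circuit of `T`, which meets `c` and is neither `c`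
  -- nor `c₁`.
  have he : ∃ e, c e ≠ 0 ∧ c₁ e = 0 := by
    by_contra! hcon
    refine hne.symm (hc₁.minimal c hc.mem hc.ne_zero ?_)
    funext e
    by_cases he : c e = 0
    · simp [he]
    · rw [Pi.mul_apply, zmod_two_eq_one (hcon e he), one_mul]
  obtain ⟨e, he, he₁⟩ := he
  have hval : (∑ c ∈ T, c) e ≠ 0 := by rw [hsum]; simpa [he₁] using he
  rw [Finset.sum_apply] at hval
  obtain ⟨c₂, hc₂, he₂⟩ := Finset.exists_ne_zero_of_sum_ne_zero hval
  exact ⟨c₂, hT c₂ hc₂, fun h => hcT (h ▸ hc₂), fun h => hcT₁ (h ▸ hc₂),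
    fun h => mul_ne_zero he he₂ (congrFun h e)⟩

/-- Without a coloop each circuit meets two others, so among at most four circuits it is disjoint
from at most one. Disjoint families then have at most two members, and those with two form a
matching on the circuits. This allows at most 1 + 4 + 2 = 7 families, fewer than eight. -/
theorem exists_isColoop_of_numCycles_le (hG : IsTricyclic G) (h : numCycles G ≤ 4) :
    ∃ c, IsColoop G c := by
  classical
  by_contra hcon
  obtain ⟨F, hF, hF'⟩ := eight_le_card_families hG
  set C := (Set.toFinite {c | IsCircuit G c}).toFinset with hC
  have hmemC : ∀ c, c ∈ C ↔ IsCircuit G c := fun c => by simp [hC]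
  have hCcard : C.card ≤ 4 := by
    rw [hC, ← Set.ncard_eq_toFinset_card]
    exact ncard_isCircuit_le_numCycles.trans h
  have two : ∀ c ∈ C, ∃ c₁ ∈ C, ∃ c₂ ∈ C, c₁ ≠ c ∧ c₂ ≠ c ∧ c₂ ≠ c₁ ∧ c * c₁ ≠ 0 ∧ c * c₂ ≠ 0 := by
    intro c hc
    have hc' := (hmemC c).1 hc
    by_contra! hno
    refine hcon ⟨c, hc'.isColoop fun c₁ h₁ hne => ?_⟩
    by_contra hm
    obtain ⟨c₂, h₂, hn, hn', hm'⟩ := hc'.exists_second h₁ hne hm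
    exact hm' (hno c₁ ((hmemC _).2 h₁) c₂ ((hmemC _).2 h₂) hne hn hn' hm)
  have star : ∀ a ∈ C, ∀ b ∈ C, ∀ b' ∈ C, b ≠ a → b' ≠ a → b ≠ b' → a * b = 0 → a * b' = 0 →
      False := by
    intro a ha b hb b' hb' h1 h2 h3 h4 h5
    obtain ⟨c₁, hc₁, c₂, hc₂, n1, n2, n3, m1, m2⟩ := two a ha
    have e1 : b ≠ c₁ := fun e => m1 (e ▸ h4)
    have e2 : b ≠ c₂ := fun e => m2 (e ▸ h4)
    have e3 : b' ≠ c₁ := fun e => m1 (e ▸ h5)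
    have e4 : b' ≠ c₂ := fun e => m2 (e ▸ h5)
    have hsub : ({a, b, b', c₁, c₂} : Finset (Sym2 V → ZMod 2)) ⊆ C := by
      intro x hx
      simp only [Finset.mem_insert, Finset.mem_singleton] at hx
      rcases hx with rfl | rfl | rfl | rfl | rfl <;> assumption
    have h5 : ({a, b, b', c₁, c₂} : Finset (Sym2 V → ZMod 2)).card = 5 := by
      rw [Finset.card_insert_of_notMem, Finset.card_insert_of_notMem, Finset.card_insert_of_notMem,
        Finset.card_pair n3.symm] <;> simp [*, Ne.symm h1, Ne.symm h2, Ne.symm n1, Ne.symm n2]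
    have := Finset.card_le_card hsub
    omega
  have hTC : ∀ T ∈ F, T ⊆ C := fun T hT c hc => (hmemC c).2 ((hF' T hT).1 c hc)
  have hle2 : ∀ T ∈ F, T.card ≤ 2 := by
    intro T hT
    by_contra! hlt
    obtain ⟨a, b, c, ha, hb, hc, hab, hac, hbc⟩ := Finset.two_lt_card_iff.1 hlt
    exact star a (hTC T hT ha) b (hTC T hT hb) c (hTC T hT hc) hab.symm hac.symm hbc
      ((hF' T hT).2 a ha b hb hab) ((hF' T hT).2 a ha c hc hac)
  set P := F.filter fun T => T.card = 2 with hP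
  have hPcard : P.card ≤ 2 := by
    have hdis : (P : Set (Finset (Sym2 V → ZMod 2))).PairwiseDisjoint id := by
      intro T hT T' hT' hne
      rw [Function.onFun, id, id, Finset.disjoint_left]
      intro a ha ha'
      simp only [hP, Finset.coe_filter, Set.mem_ofPred_eq] at hT hT'
      obtain ⟨b, hb⟩ : ∃ b, T = {a, b} ∧ a ≠ b := by
        obtain ⟨x, y, hxy, rfl⟩ := Finset.card_eq_two.1 hT.2
        rcases Finset.mem_insert.1 ha with rfl | h
        · exact ⟨y, rfl, hxy⟩
        · rw [Finset.mem_singleton.1 h]; exact ⟨x, Finset.pair_comm _ _, hxy.symm⟩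
      obtain ⟨b', hb'⟩ : ∃ b, T' = {a, b} ∧ a ≠ b := by
        obtain ⟨x, y, hxy, rfl⟩ := Finset.card_eq_two.1 hT'.2
        rcases Finset.mem_insert.1 ha' with rfl | h
        · exact ⟨y, rfl, hxy⟩
        · rw [Finset.mem_singleton.1 h]; exact ⟨x, Finset.pair_comm _ _, hxy.symm⟩
      have mb : b ∈ T := by rw [hb.1]; simp
      have mb' : b' ∈ T' := by rw [hb'.1]; simp
      refine star a (hTC T hT.1 ha) b (hTC T hT.1 mb) b' (hTC T' hT'.1 mb') hb.2.symm hb'.2.symm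
        (fun h => hne (by rw [hb.1, hb'.1, h])) ((hF' T hT.1).2 a ha b mb hb.2)
        ((hF' T' hT'.1).2 a ha' b' mb' hb'.2)
    have h1 := Finset.card_biUnion hdis
    have h2 : ∑ T ∈ P, (id T).card = P.card * 2 :=
      Finset.sum_const_nat fun T hT => (Finset.mem_filter.1 hT).2
    have h3 : P.biUnion id ⊆ C := Finset.biUnion_subset.2 fun T hT => hTC T (Finset.mem_filter.1 hT).1
    have h4 := Finset.card_le_card h3
    omega
  have hcover : F ⊆ insert ∅ (C.image singleton ∪ P) := by
    intro T hT
    have h2 := hle2 T hT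
    interval_cases hcard : T.card
    · exact Finset.mem_insert.2 (.inl (Finset.card_eq_zero.1 hcard))
    · obtain ⟨c, rfl⟩ := Finset.card_eq_one.1 hcard
      exact Finset.mem_insert_of_mem (Finset.mem_union_left _
        (Finset.mem_image_of_mem _ (hTC _ hT (Finset.mem_singleton_self c))))
    · exact Finset.mem_insert_of_mem (Finset.mem_union_right _ (Finset.mem_filter.2 ⟨hT, hcard⟩))
  have h1 := Finset.card_le_card hcover
  have h2 := Finset.card_insert_le (∅ : Finset (Sym2 V → ZMod 2)) (C.image singleton ∪ P)
  have h3 := Finset.card_union_le (C.image singleton) P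
  have h4 : (C.image (singleton : _ → Finset (Sym2 V → ZMod 2))).card ≤ C.card :=
    Finset.card_image_le
  omega

end Circuit

/-! ### Graphs with a dominating vertex -/

section StarPlus

variable {V : Type*}

/-- The graph with the edges in `F` and all edges at `z`. -/
def starPlus (z : V) (F : Set (Sym2 V)) : SimpleGraph V := fromEdgeSet {e | z ∈ e ∨ e ∈ F}

theorem starPlus_adj {z : V} {F : Set (Sym2 V)} {x y : V} :
    (starPlus z F).Adj x y ↔ (x = z ∨ y = z ∨ s(x, y) ∈ F) ∧ x ≠ y := by
  simp only [starPlus, fromEdgeSet_adj, Set.mem_ofPred_eq, Sym2.mem_iff, or_assoc, eq_comm (a := z)]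

theorem starPlus_connected (z : V) (F : Set (Sym2 V)) : (starPlus z F).Connected := by
  have hz : ∀ x, (starPlus z F).Reachable z x := fun x => by
    by_cases h : x = z
    · subst h; exact .refl _
    · exact (starPlus_adj.2 ⟨.inl rfl, Ne.symm h⟩ : (starPlus z F).Adj z x).reachable
  have : Nonempty V := ⟨z⟩
  exact ⟨fun x y => (hz x).symm.trans (hz y)⟩

theorem edgeSet_starPlus {z : V} {F : Set (Sym2 V)} (hF : ∀ e ∈ F, ¬ e.IsDiag) :
    (starPlus z F).edgeSet = (fun x => s(z, x)) '' {z}ᶜ ∪ F := by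
  ext e
  induction e using Sym2.ind with | _ x y
  rw [SimpleGraph.mem_edgeSet, starPlus_adj, Set.mem_union, Set.mem_image]
  constructor
  · rintro ⟨rfl | rfl | h, hne⟩
    · exact .inl ⟨y, hne.symm, rfl⟩
    · exact .inl ⟨x, hne, Sym2.eq_swap⟩
    · exact .inr h
  · rintro (⟨w, hw, h⟩ | h)
    · rcases Sym2.eq_iff.1 h with ⟨rfl, rfl⟩ | ⟨rfl, rfl⟩
      · exact ⟨.inl rfl, Ne.symm hw⟩
      · exact ⟨.inr (.inl rfl), hw⟩
    · exact ⟨.inr (.inr h), fun hxy => hF _ h hxy⟩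

theorem ncard_edgeSet_starPlus [Fintype V] {z : V} {F : Set (Sym2 V)} (hF : ∀ e ∈ F, ¬ e.IsDiag)
    (hz : ∀ e ∈ F, z ∉ e) :
    (starPlus z F).edgeSet.ncard + 1 = Fintype.card V + F.ncard := by
  classical
  have hcard : 0 < Fintype.card V := Fintype.card_pos_iff.2 ⟨z⟩
  rw [edgeSet_starPlus hF, Set.ncard_union_eq _ (Set.toFinite _) (Set.toFinite _),
    Set.ncard_image_of_injective _ (fun x y h => Sym2.congr_right.1 h), Set.ncard_compl,
    Set.ncard_singleton, Nat.card_eq_fintype_card]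
  · omega
  · rw [Set.disjoint_left]
    rintro _ ⟨x, -, rfl⟩ h
    exact hz _ h (Sym2.mem_mk_left _ _)

theorem eq_starPlus_of_dominating {G : SimpleGraph V} {z : V} (hz : ∀ x, x ≠ z → G.Adj z x) :
    G = starPlus z {e | e ∈ G.edgeSet ∧ z ∉ e} := by
  ext x y
  rw [starPlus_adj]
  constructor
  · intro h
    refine ⟨?_, h.ne⟩
    by_contra! hcon
    exact hcon.2.2 ⟨h, by simp [Ne.symm hcon.1, Ne.symm hcon.2.1]⟩
  · rintro ⟨rfl | rfl | h, hne⟩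
    · exact hz y hne.symm
    · exact (hz x hne).symm
    · exact h.1

/-- A dominating vertex, with three disjoint edges. -/
def IsThreeEdges (G : SimpleGraph V) : Prop :=
  ∃ z a b c d e f, [z, a, b, c, d, e, f].Nodup ∧ G = starPlus z {s(a, b), s(c, d), s(e, f)}

/-- A dominating vertex, with a path of length two and a disjoint edge. -/
def IsPathEdge (G : SimpleGraph V) : Prop :=
  ∃ z a b c d e, [z, a, b, c, d, e].Nodup ∧ G = starPlus z {s(a, b), s(b, c), s(d, e)}

/-- A dominating vertex, with a path of length three. -/
def IsPath (G : SimpleGraph V) : Prop :=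
  ∃ z a b c d, [z, a, b, c, d].Nodup ∧ G = starPlus z {s(a, b), s(b, c), s(c, d)}

/-- A dominating vertex, with a claw. -/
def IsClaw (G : SimpleGraph V) : Prop :=
  ∃ z a b c d, [z, a, b, c, d].Nodup ∧ G = starPlus z {s(a, b), s(a, c), s(a, d)}

/-- A dominating vertex, with a triangle. -/
def IsTri (G : SimpleGraph V) : Prop :=
  ∃ z a b c, [z, a, b, c].Nodup ∧ G = starPlus z {s(a, b), s(a, c), s(b, c)}

/-- The type depends on where the third edge `de` meets the path `a`, `b`, `c`. -/
theorem type_of_adjacent_edges {z a b c d e : V} (h : [z, a, b, c].Nodup) (hd : d ≠ z) (he : e ≠ z)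
    (hde : d ≠ e) (h1 : s(d, e) ≠ s(a, b)) (h2 : s(d, e) ≠ s(b, c)) :
    IsPathEdge (starPlus z {s(a, b), s(b, c), s(d, e)}) ∨
    IsPath (starPlus z {s(a, b), s(b, c), s(d, e)}) ∨
    IsClaw (starPlus z {s(a, b), s(b, c), s(d, e)}) ∨
    IsTri (starPlus z {s(a, b), s(b, c), s(d, e)}) := by
  simp only [ne_eq, Sym2.eq_iff, not_or, not_and] at h1 h2
  by_cases da : d = a
  · by_cases ec : e = c
    · refine .inr (.inr (.inr ⟨z, a, b, c, by grind, congrArg _ ?_⟩))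
      ext x; induction x using Sym2.ind; simp; grind
    · refine .inr (.inl ⟨z, e, a, b, c, by grind, congrArg _ ?_⟩)
      ext x; induction x using Sym2.ind; simp; grind
  by_cases db : d = b
  · refine .inr (.inr (.inl ⟨z, b, a, c, e, by grind, congrArg _ ?_⟩))
    ext x; induction x using Sym2.ind; simp; grind
  by_cases dc : d = c
  · by_cases ea : e = a
    · refine .inr (.inr (.inr ⟨z, a, b, c, by grind, congrArg _ ?_⟩))
      ext x; induction x using Sym2.ind; simp; grind
    · refine .inr (.inl ⟨z, a, b, c, e, by grind, congrArg _ ?_⟩)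
      ext x; induction x using Sym2.ind; simp; grind
  by_cases ea : e = a
  · refine .inr (.inl ⟨z, d, a, b, c, by grind, congrArg _ ?_⟩)
    ext x; induction x using Sym2.ind; simp; grind
  by_cases eb : e = b
  · refine .inr (.inr (.inl ⟨z, b, a, c, d, by grind, congrArg _ ?_⟩))
    ext x; induction x using Sym2.ind; simp; grind
  by_cases ec : e = c
  · refine .inr (.inl ⟨z, a, b, c, d, by grind, congrArg _ ?_⟩)
    ext x; induction x using Sym2.ind; simp; grind
  exact .inl ⟨z, a, b, c, d, e, by grind, rfl⟩

theorem type_of_ncard_eq_three {z : V} {F : Set (Sym2 V)} (hF : F.ncard = 3)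
    (hd : ∀ e ∈ F, ¬ e.IsDiag) (hz : ∀ e ∈ F, z ∉ e) :
    IsThreeEdges (starPlus z F) ∨ IsPathEdge (starPlus z F) ∨ IsPath (starPlus z F) ∨
      IsClaw (starPlus z F) ∨ IsTri (starPlus z F) := by
  obtain ⟨e₁, e₂, e₃, h12, h13, h23, rfl⟩ := Set.ncard_eq_three.1 hF
  simp only [Set.mem_insert_iff, Set.mem_singleton_iff, forall_eq_or_imp, forall_eq] at hd hz
  obtain ⟨hd1, hd2, hd3⟩ := hd
  obtain ⟨hz1, hz2, hz3⟩ := hz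
  have key : ∀ p q r : Sym2 V, ¬ p.IsDiag → ¬ q.IsDiag → ¬ r.IsDiag → z ∉ p → z ∉ q → z ∉ r →
      p ≠ q → p ≠ r → q ≠ r → (∃ x, x ∈ p ∧ x ∈ q) →
      IsPathEdge (starPlus z {p, q, r}) ∨ IsPath (starPlus z {p, q, r}) ∨
      IsClaw (starPlus z {p, q, r}) ∨ IsTri (starPlus z {p, q, r}) := by
    rintro p q r dp dq dr zp zq zr hpq hpr hqr ⟨x, hxp, hxq⟩
    obtain ⟨a, rfl⟩ := hxp
    obtain ⟨c, rfl⟩ := hxq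
    induction r using Sym2.ind with | _ d e
    simp only [Sym2.mk_isDiag_iff, Sym2.mem_iff, not_or, ne_eq, Sym2.eq_iff, not_and] at *
    rw [Sym2.eq_swap (a := x) (b := a)]
    apply type_of_adjacent_edges <;> simp <;> grind
  by_cases c12 : ∃ x, x ∈ e₁ ∧ x ∈ e₂
  · exact .inr (key _ _ _ hd1 hd2 hd3 hz1 hz2 hz3 h12 h13 h23 c12)
  by_cases c13 : ∃ x, x ∈ e₁ ∧ x ∈ e₃
  · rw [show ({e₁, e₂, e₃} : Set (Sym2 V)) = {e₁, e₃, e₂} by rw [Set.pair_comm]]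
    exact .inr (key _ _ _ hd1 hd3 hd2 hz1 hz3 hz2 h13 h12 h23.symm c13)
  by_cases c23 : ∃ x, x ∈ e₂ ∧ x ∈ e₃
  · rw [show ({e₁, e₂, e₃} : Set (Sym2 V)) = {e₂, e₃, e₁} by
      rw [Set.insert_comm, Set.pair_comm e₁ e₃]]
    exact .inr (key _ _ _ hd2 hd3 hd1 hz2 hz3 hz1 h23 h12.symm h13.symm c23)
  left
  induction e₁ using Sym2.ind with | _ a b
  induction e₂ using Sym2.ind with | _ c d
  induction e₃ using Sym2.ind with | _ e f
  refine ⟨z, a, b, c, d, e, f, ?_, rfl⟩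
  simp only [Sym2.mk_isDiag_iff, Sym2.mem_iff, not_or] at hd1 hd2 hd3 hz1 hz2 hz3 c12 c13 c23
  push Not at c12 c13 c23
  have := c12 a; have := c12 b; have := c13 a; have := c13 b; have := c23 c; have := c23 d
  simp
  grind

theorem type_of_dominating [Fintype V] {G : SimpleGraph V} (hG : IsTricyclic G) {z : V}
    (hz : ∀ x, x ≠ z → G.Adj z x) :
    IsThreeEdges G ∨ IsPathEdge G ∨ IsPath G ∨ IsClaw G ∨ IsTri G := by
  have hd : ∀ e ∈ {e | e ∈ G.edgeSet ∧ z ∉ e}, ¬ e.IsDiag := fun e he =>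
    G.not_isDiag_of_mem_edgeSet he.1
  have hz' : ∀ e ∈ {e | e ∈ G.edgeSet ∧ z ∉ e}, z ∉ e := fun e he => he.2
  -- Of the n + 2 edges, n - 1 contain `z`, so three avoid it.
  have hcard := ncard_edgeSet_starPlus hd hz'
  rw [← eq_starPlus_of_dominating hz, hG.2] at hcard
  have := type_of_ncard_eq_three (by omega) hd hz'
  rwa [← eq_starPlus_of_dominating hz] at this

theorem isTricyclic_starPlus [Fintype V] {z : V} {F : Set (Sym2 V)} (hF : F.ncard = 3)
    (hd : ∀ e ∈ F, ¬ e.IsDiag) (hz : ∀ e ∈ F, z ∉ e) : IsTricyclic (starPlus z F) :=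
  ⟨starPlus_connected z F, by have := ncard_edgeSet_starPlus hd hz; omega⟩

theorem IsPathEdge.isTricyclic [Fintype V] {G : SimpleGraph V} (h : IsPathEdge G) :
    IsTricyclic G := by
  obtain ⟨z, a, b, c, d, e, h, rfl⟩ := h
  refine isTricyclic_starPlus (Set.ncard_eq_three.2 ⟨_, _, _, ?_, ?_, ?_, rfl⟩) ?_ ?_ <;>
    simp at h ⊢ <;> grind

theorem IsClaw.isTricyclic [Fintype V] {G : SimpleGraph V} (h : IsClaw G) :
    IsTricyclic G := by
  obtain ⟨z, a, b, c, d, h, rfl⟩ := h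
  refine isTricyclic_starPlus (Set.ncard_eq_three.2 ⟨_, _, _, ?_, ?_, ?_, rfl⟩) ?_ ?_ <;>
    simp at h ⊢ <;> grind

theorem IsTri.isTricyclic [Fintype V] {G : SimpleGraph V} (h : IsTri G) :
    IsTricyclic G := by
  obtain ⟨z, a, b, c, h, rfl⟩ := h
  refine isTricyclic_starPlus (Set.ncard_eq_three.2 ⟨_, _, _, ?_, ?_, ?_, rfl⟩) ?_ ?_ <;>
    simp at h ⊢ <;> grind

/-! ### Comparison of the types by Kelmans transformations -/

/-- The edge `cd` becomes `ad`, while `z` stays joined to both as a common neighbour. Here `u` and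
`v` are not adjacent, which `IsKelmans.SLEE_lt` permits. The next two lemmas turn `de` into `be` and
`cd` into `bd`. -/
theorem IsThreeEdges.exists_lt [Fintype V] [DecidableEq V] {G : SimpleGraph V}
    (h : IsThreeEdges G) : ∃ G' : SimpleGraph V, IsPathEdge G' ∧ SLEE G < SLEE G' := by
  obtain ⟨z, a, b, c, d, e, f, h, rfl⟩ := h
  simp only [List.nodup_cons, List.mem_cons, not_or, List.not_mem_nil] at h
  refine ⟨_, ⟨z, b, a, d, e, f, by simp; grind, rfl⟩, IsKelmans.SLEE_lt (u := a) (v := c)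
    (a := b) (b := d) ⟨?_, ?_, ?_, ?_, ?_⟩ ?_ ?_ ?_ ?_ ?_ ?_⟩ <;>
    (try simp only [starPlus_adj, Set.mem_insert_iff, Set.mem_singleton_iff, Sym2.eq_iff]) <;>
    grind

theorem IsPathEdge.exists_lt [Fintype V] [DecidableEq V] {G : SimpleGraph V}
    (h : IsPathEdge G) : ∃ G' : SimpleGraph V, IsClaw G' ∧ SLEE G < SLEE G' := by
  obtain ⟨z, a, b, c, d, e, h, rfl⟩ := h
  simp only [List.nodup_cons, List.mem_cons, not_or, List.not_mem_nil] at h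
  refine ⟨_, ⟨z, b, a, c, e, by simp; grind, rfl⟩, IsKelmans.SLEE_lt (u := b) (v := d)
    (a := a) (b := e) ⟨?_, ?_, ?_, ?_, ?_⟩ ?_ ?_ ?_ ?_ ?_ ?_⟩ <;>
    (try simp only [starPlus_adj, Set.mem_insert_iff, Set.mem_singleton_iff, Sym2.eq_iff]) <;>
    grind

theorem IsPath.exists_lt [Fintype V] [DecidableEq V] {G : SimpleGraph V}
    (h : IsPath G) : ∃ G' : SimpleGraph V, IsClaw G' ∧ SLEE G < SLEE G' := by
  obtain ⟨z, a, b, c, d, h, rfl⟩ := h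
  simp only [List.nodup_cons, List.mem_cons, not_or, List.not_mem_nil] at h
  refine ⟨_, ⟨z, b, a, c, d, by simp; grind, rfl⟩, IsKelmans.SLEE_lt (u := b) (v := c)
    (a := a) (b := d) ⟨?_, ?_, ?_, ?_, ?_⟩ ?_ ?_ ?_ ?_ ?_ ?_⟩ <;>
    (try simp only [starPlus_adj, Set.mem_insert_iff, Set.mem_singleton_iff, Sym2.eq_iff]) <;>
    grind

/-! ### Coloops of graphs with a dominating vertex -/

section Coloops

variable [Fintype V] {z : V} {F : Set (Sym2 V)}

/-- If an even set contains `zy`, it has a second edge at `y`, and that edge avoids `z`. -/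
theorem exists_mem_of_mem_evenSpace_starPlus {c : Sym2 V → ZMod 2}
    (hc : c ∈ evenSpace (starPlus z F)) (hc0 : c ≠ 0) : ∃ e ∈ F, c e ≠ 0 := by
  obtain ⟨e, he⟩ := Function.ne_iff.1 hc0
  induction e using Sym2.ind with | _ x y
  simp only [Pi.zero_apply] at he
  have key : ∀ y, c s(z, y) ≠ 0 → ∃ e ∈ F, c e ≠ 0 := fun y hy => by
    rw [Sym2.eq_swap] at hy
    obtain ⟨w, hw, -, hyw⟩ := exists_ne_of_mem_evenSpace hc hy
    have hyz : y ≠ z := fun h => hy (h ▸ diag_of_mem_evenSpace hc y)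
    have := (starPlus_adj.1 (adj_of_mem_evenSpace hc hyw)).1
    exact ⟨_, (this.resolve_left hyz).resolve_left hw, hyw⟩
  by_cases hx : x = z
  · subst hx; exact key y he
  by_cases hy : y = z
  · subst hy; rw [Sym2.eq_swap] at he; exact key x he
  have := (starPlus_adj.1 (adj_of_mem_evenSpace hc he)).1
  exact ⟨_, (this.resolve_left hx).resolve_left hy, he⟩

/-- The triangles on `z`, `y`, `w₁` and on `z`, `y`, `w₂` share the edge `zy`. -/
theorem IsColoop.eq_zero_of_starPlus {c : Sym2 V → ZMod 2} (hc : IsColoop (starPlus z F) c)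
    {y w₁ w₂ : V} (h : [z, y, w₁, w₂].Nodup) (h₁ : s(y, w₁) ∈ F) (h₂ : s(y, w₂) ∈ F) :
    c s(y, w₁) = 0 := by
  classical
  simp only [List.nodup_cons, List.mem_cons, not_or, List.not_mem_nil] at h
  apply hc.eq_zero_of_diamond (u := z) (w₂ := w₂) <;> (try rw [starPlus_adj]) <;> grind

end Coloops

variable [Fintype V] {G : SimpleGraph V}

/-- A coloop contains an edge that avoids `z`, but each of these meets another one and is excluded
by `IsColoop.eq_zero_of_starPlus`. The same holds for claws and triangles. -/
theorem IsPath.not_isColoop (h : IsPath G) (c : Sym2 V → ZMod 2) : ¬ IsColoop G c := by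
  obtain ⟨z, a₁, a₂, a₃, a₄, h, rfl⟩ := h
  intro hc
  simp only [List.nodup_cons, List.mem_cons, not_or, List.not_mem_nil] at h
  obtain ⟨e, he, hce⟩ := exists_mem_of_mem_evenSpace_starPlus hc.mem hc.ne_zero
  simp only [Set.mem_insert_iff, Set.mem_singleton_iff] at he
  apply hce
  rcases he with rfl | rfl | rfl
  · rw [Sym2.eq_swap]
    apply hc.eq_zero_of_starPlus (w₂ := a₃) <;> simp
    grind
  · apply hc.eq_zero_of_starPlus (w₂ := a₁) <;> simp
    grind
  · apply hc.eq_zero_of_starPlus (w₂ := a₂) <;> simp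
    grind

theorem IsClaw.not_isColoop (h : IsClaw G) (c : Sym2 V → ZMod 2) : ¬ IsColoop G c := by
  obtain ⟨z, a₁, a₂, a₃, a₄, h, rfl⟩ := h
  intro hc
  simp only [List.nodup_cons, List.mem_cons, not_or, List.not_mem_nil] at h
  obtain ⟨e, he, hce⟩ := exists_mem_of_mem_evenSpace_starPlus hc.mem hc.ne_zero
  simp only [Set.mem_insert_iff, Set.mem_singleton_iff] at he
  apply hce
  rcases he with rfl | rfl | rfl
  · apply hc.eq_zero_of_starPlus (w₂ := a₃) <;> simp
    grind
  · apply hc.eq_zero_of_starPlus (w₂ := a₂) <;> simp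
    grind
  · apply hc.eq_zero_of_starPlus (w₂ := a₂) <;> simp
    grind

theorem IsTri.not_isColoop (h : IsTri G) (c : Sym2 V → ZMod 2) : ¬ IsColoop G c := by
  obtain ⟨z, a₁, a₂, a₃, h, rfl⟩ := h
  intro hc
  simp only [List.nodup_cons, List.mem_cons, not_or, List.not_mem_nil] at h
  obtain ⟨e, he, hce⟩ := exists_mem_of_mem_evenSpace_starPlus hc.mem hc.ne_zero
  simp only [Set.mem_insert_iff, Set.mem_singleton_iff] at he
  apply hce
  rcases he with rfl | rfl | rfl
  · apply hc.eq_zero_of_starPlus (w₂ := a₃) <;> simp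
    grind
  · apply hc.eq_zero_of_starPlus (w₂ := a₂) <;> simp
    grind
  · apply hc.eq_zero_of_starPlus (w₂ := a₁) <;> simp
    grind

theorem IsPathEdge.coloop_unique (h : IsPathEdge G) {c₁ c₂ : Sym2 V → ZMod 2} (h₁ : IsColoop G c₁)
    (h₂ : IsColoop G c₂) : c₁ = c₂ := by
  obtain ⟨z, a₁, a₂, a₃, a₄, a₅, h, rfl⟩ := h
  simp only [List.nodup_cons, List.mem_cons, not_or, List.not_mem_nil] at h
  -- The isolated outer edge is the only one that a coloop can contain, so any two coloops meet
  -- there.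
  have key : ∀ c, IsColoop (starPlus z {s(a₁, a₂), s(a₂, a₃), s(a₄, a₅)}) c → c s(a₄, a₅) ≠ 0 := by
    intro c hc
    obtain ⟨e, he, hce⟩ := exists_mem_of_mem_evenSpace_starPlus hc.mem hc.ne_zero
    simp only [Set.mem_insert_iff, Set.mem_singleton_iff] at he
    rcases he with rfl | rfl | rfl
    · refine absurd ?_ hce
      rw [Sym2.eq_swap]
      apply hc.eq_zero_of_starPlus (w₂ := a₃) <;> simp
      grind
    · refine absurd ?_ hce
      apply hc.eq_zero_of_starPlus (w₂ := a₁) <;> simp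
      grind
    · exact hce
  by_contra hne
  exact mul_ne_zero (key c₁ h₁) (key c₂ h₂) (congrFun (h₁.mul_eq_zero h₂ hne) _)

end StarPlus

/-! ### The numbers of cycles of the types -/

section Count

variable {V : Type*} {G : SimpleGraph V}

theorem triangle_mem_cycleEdgeSets {a b c : V} (hab : G.Adj a b) (hbc : G.Adj b c)
    (hca : G.Adj c a) : {s(a, b), s(b, c), s(c, a)} ∈ cycleEdgeSets G := by
  refine ⟨a, .cons hab (.cons hbc (.cons hca .nil)), ?_, by ext; simp⟩
  have := hab.ne
  have := hbc.ne
  have := hca.ne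
  rw [Walk.isCycle_def, Walk.isTrail_def]
  simp
  grind

theorem quadrangle_mem_cycleEdgeSets {a b c d : V} (hab : G.Adj a b) (hbc : G.Adj b c)
    (hcd : G.Adj c d) (hda : G.Adj d a) (hac : a ≠ c) (hbd : b ≠ d) :
    {s(a, b), s(b, c), s(c, d), s(d, a)} ∈ cycleEdgeSets G := by
  refine ⟨a, .cons hab (.cons hbc (.cons hcd (.cons hda .nil))), ?_, by ext; simp⟩
  have := hab.ne
  have := hbc.ne
  have := hcd.ne
  have := hda.ne
  rw [Walk.isCycle_def, Walk.isTrail_def]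
  simp
  grind

theorem range_vecThree (p q r : Sym2 V) : ({p, q, r} : Set (Sym2 V)) = Set.range ![p, q, r] := by
  simp [Set.insert_def, or_comm, eq_comm]

variable [Fintype V]

theorem not_three_edges_at {s : Set (Sym2 V)} (hs : s ∈ cycleEdgeSets G) {x a b c : V}
    (ha : s(x, a) ∈ s) (hb : s(x, b) ∈ s) (hc : s(x, c) ∈ s) (hab : a ≠ b) (hac : a ≠ c)
    (hbc : b ≠ c) : False := by
  have h2 := ncard_edges_at_of_mem_cycleEdgeSets hs ha
  have h3 : ({a, b, c} : Set V).ncard = 3 := Set.ncard_eq_three.2 ⟨a, b, c, hab, hac, hbc, rfl⟩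
  have hsub : ({a, b, c} : Set V) ⊆ {w | s(x, w) ∈ s} := by
    rintro w (rfl | rfl | rfl) <;> assumption
  have := Set.ncard_le_ncard hsub (Set.toFinite _)
  omega

theorem mem_of_only_two_neighbors {s : Set (Sym2 V)} (hs : s ∈ cycleEdgeSets G) {a b z : V}
    (hab : s(a, b) ∈ s) (hnb : ∀ w, G.Adj a w → w = z ∨ w = b) : s(z, a) ∈ s := by
  obtain ⟨w, hwb, -, hw⟩ := exists_ne_of_mem_evenSpace (edgeInd_mem hs) (edgeInd_ne_zero.2 hab)
  have := (hnb w (adj_of_mem_evenSpace (edgeInd_mem hs) hw)).resolve_right hwb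
  rw [Sym2.eq_swap, ← this]
  exact edgeInd_ne_zero.1 hw

/-- A cycle is determined by the outer edges it contains, since two cycles with the same outer edges
differ by an even set inside the star. Thus `R` lists the sets of outer edges that cycles realise,
and the cycles are counted by it. -/
theorem numCycles_starPlus {z : V} (f : Fin 3 → Sym2 V) (R : Finset (Finset (Fin 3)))
    (hR : ∀ T ∈ R, ∃ s ∈ cycleEdgeSets (starPlus z (Set.range f)), ∀ i, f i ∈ s ↔ i ∈ T)
    (hR' : ∀ s ∈ cycleEdgeSets (starPlus z (Set.range f)), ∀ T : Finset (Fin 3), T.Nonempty →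
      (∀ i, f i ∈ s ↔ i ∈ T) → T ∈ R) :
    numCycles (starPlus z (Set.range f)) = R.card := by
  classical
  rw [← Set.ncard_coe_finset]
  refine Set.ncard_congr (fun s _ => Finset.univ.filter fun i => f i ∈ s) ?_ ?_ ?_
  · intro s hs
    refine hR' s hs _ ?_ (by simp)
    obtain ⟨e, ⟨i, rfl⟩, he⟩ := exists_mem_of_mem_evenSpace_starPlus (edgeInd_mem hs)
      (edgeInd_ne_zero_of_mem hs)
    exact ⟨i, by simpa using edgeInd_ne_zero.1 he⟩
  · intro s s' hs hs' h
    have hsub : edgeInd s - edgeInd s' = 0 := by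
      by_contra hne
      obtain ⟨e, ⟨i, rfl⟩, he⟩ := exists_mem_of_mem_evenSpace_starPlus
        (Submodule.sub_mem _ (edgeInd_mem hs) (edgeInd_mem hs')) hne
      have hi : f i ∈ s ↔ f i ∈ s' := by simpa using Finset.ext_iff.1 h i
      exact he (by simp [edgeInd, hi])
    rw [sub_eq_zero] at hsub
    ext e
    rw [← edgeInd_ne_zero, hsub, edgeInd_ne_zero]
  · intro T hT
    obtain ⟨s, hs, h⟩ := hR T hT
    exact ⟨s, hs, by ext i; simp [h]⟩

theorem IsThreeEdges.numCycles_eq (h : IsThreeEdges G) : numCycles G = 3 := by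
  obtain ⟨z, a, b, c, d, e, f, h, rfl⟩ := h
  simp only [List.nodup_cons, List.mem_cons, not_or, List.not_mem_nil] at h
  rw [range_vecThree]
  refine numCycles_starPlus (V := V) _ {{0}, {1}, {2}} ?_ ?_
  · rw [← range_vecThree]
    intro T hT
    simp only [Finset.mem_insert, Finset.mem_singleton] at hT
    rcases hT with rfl | rfl | rfl
    · refine ⟨_, triangle_mem_cycleEdgeSets (a := z) (b := a) (c := b) ?_ ?_ ?_, ?_⟩ <;>
        simp [starPlus_adj, Fin.forall_fin_succ] <;> grind
    · refine ⟨_, triangle_mem_cycleEdgeSets (a := z) (b := c) (c := d) ?_ ?_ ?_, ?_⟩ <;>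
        simp [starPlus_adj, Fin.forall_fin_succ] <;> grind
    · refine ⟨_, triangle_mem_cycleEdgeSets (a := z) (b := e) (c := f) ?_ ?_ ?_, ?_⟩ <;>
        simp [starPlus_adj, Fin.forall_fin_succ] <;> grind
  · rw [← range_vecThree]
    intro s hs T hT hsT
    -- A cycle through an isolated outer edge uses two edges at `z`, so a second outer edge would
    -- produce a third one there.
    have hab : s(a, b) ∈ s → s(z, a) ∈ s ∧ s(z, b) ∈ s := fun hm =>
      ⟨mem_of_only_two_neighbors hs hm (by simp [starPlus_adj]; grind),
        mem_of_only_two_neighbors hs (Sym2.eq_swap ▸ hm) (by simp [starPlus_adj]; grind)⟩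
    have hcd : s(c, d) ∈ s → s(z, c) ∈ s ∧ s(z, d) ∈ s := fun hm =>
      ⟨mem_of_only_two_neighbors hs hm (by simp [starPlus_adj]; grind),
        mem_of_only_two_neighbors hs (Sym2.eq_swap ▸ hm) (by simp [starPlus_adj]; grind)⟩
    have hef : s(e, f) ∈ s → s(z, e) ∈ s ∧ s(z, f) ∈ s := fun hm =>
      ⟨mem_of_only_two_neighbors hs hm (by simp [starPlus_adj]; grind),
        mem_of_only_two_neighbors hs (Sym2.eq_swap ▸ hm) (by simp [starPlus_adj]; grind)⟩
    have h0 := hsT 0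
    have h1 := hsT 1
    have h2 := hsT 2
    simp only [Matrix.cons_val] at h0 h1 h2
    by_contra hcon
    have key : ∀ T : Finset (Fin 3), T.Nonempty → T ∉ ({{0}, {1}, {2}} : Finset (Finset (Fin 3))) →
      (0 ∈ T ∧ 1 ∈ T) ∨ (0 ∈ T ∧ 2 ∈ T) ∨ (1 ∈ T ∧ 2 ∈ T) := by decide
    rcases key T hT hcon with ⟨k1, k2⟩ | ⟨k1, k2⟩ | ⟨k1, k2⟩
    · exact not_three_edges_at hs (hab (h0.2 k1)).1 (hab (h0.2 k1)).2 (hcd (h1.2 k2)).1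
        (by grind) (by grind) (by grind)
    · exact not_three_edges_at hs (hab (h0.2 k1)).1 (hab (h0.2 k1)).2 (hef (h2.2 k2)).1
        (by grind) (by grind) (by grind)
    · exact not_three_edges_at hs (hcd (h1.2 k1)).1 (hcd (h1.2 k1)).2 (hef (h2.2 k2)).1
        (by grind) (by grind) (by grind)

theorem IsPathEdge.numCycles_eq (h : IsPathEdge G) : numCycles G = 4 := by
  obtain ⟨z, a, b, c, d, e, h, rfl⟩ := h
  simp only [List.nodup_cons, List.mem_cons, not_or, List.not_mem_nil] at h
  rw [range_vecThree]
  refine numCycles_starPlus (V := V) _ {{0}, {1}, {2}, {0, 1}} ?_ ?_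
  · rw [← range_vecThree]
    intro T hT
    simp only [Finset.mem_insert, Finset.mem_singleton] at hT
    rcases hT with rfl | rfl | rfl | rfl
    · refine ⟨_, triangle_mem_cycleEdgeSets (a := z) (b := a) (c := b) ?_ ?_ ?_, ?_⟩ <;>
        simp [starPlus_adj, Fin.forall_fin_succ] <;> grind
    · refine ⟨_, triangle_mem_cycleEdgeSets (a := z) (b := b) (c := c) ?_ ?_ ?_, ?_⟩ <;>
        simp [starPlus_adj, Fin.forall_fin_succ] <;> grind
    · refine ⟨_, triangle_mem_cycleEdgeSets (a := z) (b := d) (c := e) ?_ ?_ ?_, ?_⟩ <;>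
        simp [starPlus_adj, Fin.forall_fin_succ] <;> grind
    · refine ⟨_, quadrangle_mem_cycleEdgeSets (a := z) (b := a) (c := b) (d := c)
        ?_ ?_ ?_ ?_ ?_ ?_, ?_⟩ <;>
        simp [starPlus_adj, Fin.forall_fin_succ] <;> grind
  · rw [← range_vecThree]
    intro s hs T hT hsT
    have hab : s(a, b) ∈ s → s(z, a) ∈ s := fun hm =>
      mem_of_only_two_neighbors hs hm (by simp [starPlus_adj]; grind)
    have hbc : s(b, c) ∈ s → s(z, c) ∈ s := fun hm =>
      mem_of_only_two_neighbors hs (Sym2.eq_swap ▸ hm) (by simp [starPlus_adj]; grind)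
    have hde : s(d, e) ∈ s → s(z, d) ∈ s ∧ s(z, e) ∈ s := fun hm =>
      ⟨mem_of_only_two_neighbors hs hm (by simp [starPlus_adj]; grind),
        mem_of_only_two_neighbors hs (Sym2.eq_swap ▸ hm) (by simp [starPlus_adj]; grind)⟩
    have h0 := hsT 0
    have h1 := hsT 1
    have h2 := hsT 2
    simp only [Matrix.cons_val] at h0 h1 h2
    by_contra hcon
    have key : ∀ T : Finset (Fin 3), T.Nonempty →
      T ∉ ({{0}, {1}, {2}, {0, 1}} : Finset (Finset (Fin 3))) →
      (0 ∈ T ∧ 2 ∈ T) ∨ (1 ∈ T ∧ 2 ∈ T) := by decide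
    rcases key T hT hcon with ⟨k1, k2⟩ | ⟨k1, k2⟩
    · exact not_three_edges_at hs (hab (h0.2 k1)) (hde (h2.2 k2)).1 (hde (h2.2 k2)).2
        (by grind) (by grind) (by grind)
    · exact not_three_edges_at hs (hbc (h1.2 k1)) (hde (h2.2 k2)).1 (hde (h2.2 k2)).2
        (by grind) (by grind) (by grind)

theorem IsClaw.numCycles_eq (h : IsClaw G) : numCycles G = 6 := by
  obtain ⟨z, a, b, c, d, h, rfl⟩ := h
  simp only [List.nodup_cons, List.mem_cons, not_or, List.not_mem_nil] at h
  rw [range_vecThree]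
  refine numCycles_starPlus (V := V) _ {{0}, {1}, {2}, {0, 1}, {0, 2}, {1, 2}} ?_ ?_
  · rw [← range_vecThree]
    intro T hT
    simp only [Finset.mem_insert, Finset.mem_singleton] at hT
    rcases hT with rfl | rfl | rfl | rfl | rfl | rfl
    · refine ⟨_, triangle_mem_cycleEdgeSets (a := z) (b := a) (c := b) ?_ ?_ ?_, ?_⟩ <;>
        simp [starPlus_adj, Fin.forall_fin_succ] <;> grind
    · refine ⟨_, triangle_mem_cycleEdgeSets (a := z) (b := a) (c := c) ?_ ?_ ?_, ?_⟩ <;>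
        simp [starPlus_adj, Fin.forall_fin_succ] <;> grind
    · refine ⟨_, triangle_mem_cycleEdgeSets (a := z) (b := a) (c := d) ?_ ?_ ?_, ?_⟩ <;>
        simp [starPlus_adj, Fin.forall_fin_succ] <;> grind
    · refine ⟨_, quadrangle_mem_cycleEdgeSets (a := z) (b := b) (c := a) (d := c)
        ?_ ?_ ?_ ?_ ?_ ?_, ?_⟩ <;>
        simp [starPlus_adj, Fin.forall_fin_succ] <;> grind
    · refine ⟨_, quadrangle_mem_cycleEdgeSets (a := z) (b := b) (c := a) (d := d)
        ?_ ?_ ?_ ?_ ?_ ?_, ?_⟩ <;>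
        simp [starPlus_adj, Fin.forall_fin_succ] <;> grind
    · refine ⟨_, quadrangle_mem_cycleEdgeSets (a := z) (b := c) (c := a) (d := d)
        ?_ ?_ ?_ ?_ ?_ ?_, ?_⟩ <;>
        simp [starPlus_adj, Fin.forall_fin_succ] <;> grind
  · rw [← range_vecThree]
    intro s hs T hT hsT
    have h0 := hsT 0
    have h1 := hsT 1
    have h2 := hsT 2
    simp only [Matrix.cons_val] at h0 h1 h2
    by_contra hcon
    have key : ∀ T : Finset (Fin 3), T.Nonempty →
      T ∉ ({{0}, {1}, {2}, {0, 1}, {0, 2}, {1, 2}} : Finset (Finset (Fin 3))) →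
      0 ∈ T ∧ 1 ∈ T ∧ 2 ∈ T := by decide
    obtain ⟨k0, k1, k2⟩ := key T hT hcon
    -- Only the full set is excluded: it has three edges at the centre of the claw.
    exact not_three_edges_at hs (h0.2 k0) (h1.2 k1) (h2.2 k2) (by grind) (by grind) (by grind)

theorem IsTri.numCycles_eq (h : IsTri G) : numCycles G = 7 := by
  obtain ⟨z, a, b, c, h, rfl⟩ := h
  simp only [List.nodup_cons, List.mem_cons, not_or, List.not_mem_nil] at h
  rw [range_vecThree]
  refine numCycles_starPlus (V := V) _ {{0}, {1}, {2}, {0, 1}, {0, 2}, {1, 2}, {0, 1, 2}} ?_ ?_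
  · rw [← range_vecThree]
    intro T hT
    simp only [Finset.mem_insert, Finset.mem_singleton] at hT
    rcases hT with rfl | rfl | rfl | rfl | rfl | rfl | rfl
    · refine ⟨_, triangle_mem_cycleEdgeSets (a := z) (b := a) (c := b) ?_ ?_ ?_, ?_⟩ <;>
        simp [starPlus_adj, Fin.forall_fin_succ] <;> grind
    · refine ⟨_, triangle_mem_cycleEdgeSets (a := z) (b := a) (c := c) ?_ ?_ ?_, ?_⟩ <;>
        simp [starPlus_adj, Fin.forall_fin_succ] <;> grind
    · refine ⟨_, triangle_mem_cycleEdgeSets (a := z) (b := b) (c := c) ?_ ?_ ?_, ?_⟩ <;>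
        simp [starPlus_adj, Fin.forall_fin_succ] <;> grind
    · refine ⟨_, quadrangle_mem_cycleEdgeSets (a := z) (b := b) (c := a) (d := c)
        ?_ ?_ ?_ ?_ ?_ ?_, ?_⟩ <;>
        simp [starPlus_adj, Fin.forall_fin_succ] <;> grind
    · refine ⟨_, quadrangle_mem_cycleEdgeSets (a := z) (b := a) (c := b) (d := c)
        ?_ ?_ ?_ ?_ ?_ ?_, ?_⟩ <;>
        simp [starPlus_adj, Fin.forall_fin_succ] <;> grind
    · refine ⟨_, quadrangle_mem_cycleEdgeSets (a := z) (b := a) (c := c) (d := b)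
        ?_ ?_ ?_ ?_ ?_ ?_, ?_⟩ <;>
        simp [starPlus_adj, Fin.forall_fin_succ] <;> grind
    · refine ⟨_, triangle_mem_cycleEdgeSets (a := a) (b := b) (c := c) ?_ ?_ ?_, ?_⟩ <;>
        simp [starPlus_adj, Fin.forall_fin_succ] <;> grind
  · intro s _ T hT _
    have key : ∀ T : Finset (Fin 3), T.Nonempty →
      T ∈ ({{0}, {1}, {2}, {0, 1}, {0, 2}, {1, 2}, {0, 1, 2}} : Finset (Finset (Fin 3))) := by
      decide
    exact key T hT

end Count

/-! ### The isomorphisms with the extremal graphs -/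

section Iso

variable {V : Type*} [Fintype V] {n : ℕ}

theorem exists_equiv_fin {b : ℕ} (hn : Fintype.card V = n) (p : Fin b → V)
    (hp : Function.Injective p) : ∃ e : V ≃ Fin n, ∀ x i, (e x).val = i.val ↔ x = p i := by
  classical
  have hbn : b ≤ n := by
    have := Fintype.card_le_of_injective p hp
    rwa [Fintype.card_fin, hn] at this
  suffices ∃ e : V ≃ Fin n, ∀ i, (e (p i)) = Fin.castLE hbn i by
    obtain ⟨e, he⟩ := this
    refine ⟨e, fun x i => ?_⟩
    rw [← e.apply_eq_iff_eq, he, Fin.ext_iff, Fin.val_castLE]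
  rcases Nat.eq_zero_or_pos b with rfl | hb
  · exact ⟨Fintype.equivFinOfCardEq hn, fun i => i.elim0⟩
  -- The values for k ≥ b are irrelevant, as only the restriction to k < b is extended to a
  -- bijection; the filler needs b > 0.
  set f : Fin n → V := fun k => if h : k.val < b then p ⟨k, h⟩ else p ⟨0, hb⟩ with hf
  obtain ⟨g, hg⟩ := Finset.exists_equiv_extend_of_card_eq (t := (Finset.univ : Finset V))
    (s := Finset.univ.filter fun k : Fin n => k.val < b) (f := f)
    (by rw [Fintype.card_fin, Finset.card_univ, hn]) (Finset.subset_univ _) (by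
      intro k hk k' hk' h
      simp only [Finset.coe_filter, Finset.mem_univ, true_and, Set.mem_ofPred_eq] at hk hk'
      simp only [hf, hk, hk', dif_pos] at h
      simpa [Fin.ext_iff] using hp h)
  refine ⟨(g.trans (Equiv.subtypeUnivEquiv (by simp))).symm, fun i => ?_⟩
  rw [Equiv.symm_apply_eq, Equiv.trans_apply, Equiv.subtypeUnivEquiv_apply, hg _ (by simp)]
  simp [hf]

/-- `fromRel` symmetrises the relation as a whole, `Sym2.eq_iff` each edge separately; this
reconciles the two forms. -/
theorem adj_shuffle {n p q a₁ a₂ a₃ a₄ a₅ a₆ b₁ b₂ b₃ b₄ b₅ b₆ : Prop} :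
    (n ∧ ((p ∨ a₁ ∧ b₂ ∨ a₃ ∧ b₄ ∨ a₅ ∧ b₆) ∨ q ∨ b₁ ∧ a₂ ∨ b₃ ∧ a₄ ∨ b₅ ∧ a₆)) ↔
    (p ∨ q ∨ (a₁ ∧ b₂ ∨ a₂ ∧ b₁) ∨ (a₃ ∧ b₄ ∨ a₄ ∧ b₃) ∨ (a₅ ∧ b₆ ∨ a₆ ∧ b₅)) ∧ n := by
  rw [and_comm, and_congr_left_iff, and_comm (a := b₁), and_comm (a := b₃), and_comm (a := b₅)]
  generalize (a₁ ∧ b₂) = c₁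
  generalize (a₂ ∧ b₁) = c₂
  generalize (a₃ ∧ b₄) = c₃
  generalize (a₄ ∧ b₃) = c₄
  generalize (a₅ ∧ b₆) = c₅
  generalize (a₆ ∧ b₅) = c₆
  tauto

variable {G : SimpleGraph V}

theorem IsThreeEdges.nonempty_iso (hn : Fintype.card V = n) (h : IsThreeEdges G) :
    Nonempty (G ≃g extremalGraph 3 n) := by
  obtain ⟨z, a, b, c, d, e, f, h, rfl⟩ := h
  obtain ⟨φ, hφ⟩ := exists_equiv_fin hn ![z, a, b, c, d, e, f]
    (List.nodup_ofFn.1 (by simpa using h))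
  refine ⟨φ, fun {x y} => ?_⟩
  have key : ∀ x, ((φ x).val = 0 ↔ x = z) ∧ ((φ x).val = 1 ↔ x = a) ∧ ((φ x).val = 2 ↔ x = b) ∧ ((φ x).val = 3 ↔ x = c) ∧ ((φ x).val = 4 ↔ x = d) ∧ ((φ x).val = 5 ↔ x = e) ∧ ((φ x).val = 6 ↔ x = f) := fun x =>
    ⟨hφ x 0, hφ x 1, hφ x 2, hφ x 3, hφ x 4, hφ x 5, hφ x 6⟩
  have hx := key x
  have hy := key y
  simp only [extremalGraph, outerEdges, fromRel_adj, starPlus_adj, List.mem_cons, Prod.mk.injEq,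
    List.not_mem_nil, or_false, Set.mem_insert_iff, Set.mem_singleton_iff, Sym2.eq_iff, hx, hy,
    ne_eq, φ.apply_eq_iff_eq]
  exact adj_shuffle

theorem IsPathEdge.nonempty_iso (hn : Fintype.card V = n) (h : IsPathEdge G) :
    Nonempty (G ≃g extremalGraph 4 n) := by
  obtain ⟨z, a, b, c, d, e, h, rfl⟩ := h
  obtain ⟨φ, hφ⟩ := exists_equiv_fin hn ![z, a, b, c, d, e]
    (List.nodup_ofFn.1 (by simpa using h))
  refine ⟨φ, fun {x y} => ?_⟩
  have key : ∀ x, ((φ x).val = 0 ↔ x = z) ∧ ((φ x).val = 1 ↔ x = a) ∧ ((φ x).val = 2 ↔ x = b) ∧ ((φ x).val = 3 ↔ x = c) ∧ ((φ x).val = 4 ↔ x = d) ∧ ((φ x).val = 5 ↔ x = e) := fun x =>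
    ⟨hφ x 0, hφ x 1, hφ x 2, hφ x 3, hφ x 4, hφ x 5⟩
  have hx := key x
  have hy := key y
  simp only [extremalGraph, outerEdges, fromRel_adj, starPlus_adj, List.mem_cons, Prod.mk.injEq,
    List.not_mem_nil, or_false, Set.mem_insert_iff, Set.mem_singleton_iff, Sym2.eq_iff, hx, hy,
    ne_eq, φ.apply_eq_iff_eq]
  exact adj_shuffle

theorem IsClaw.nonempty_iso (hn : Fintype.card V = n) (h : IsClaw G) :
    Nonempty (G ≃g extremalGraph 6 n) := by
  obtain ⟨z, a, b, c, d, h, rfl⟩ := h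
  obtain ⟨φ, hφ⟩ := exists_equiv_fin hn ![z, a, b, c, d]
    (List.nodup_ofFn.1 (by simpa using h))
  refine ⟨φ, fun {x y} => ?_⟩
  have key : ∀ x, ((φ x).val = 0 ↔ x = z) ∧ ((φ x).val = 1 ↔ x = a) ∧ ((φ x).val = 2 ↔ x = b) ∧ ((φ x).val = 3 ↔ x = c) ∧ ((φ x).val = 4 ↔ x = d) := fun x =>
    ⟨hφ x 0, hφ x 1, hφ x 2, hφ x 3, hφ x 4⟩
  have hx := key x
  have hy := key y
  simp only [extremalGraph, outerEdges, fromRel_adj, starPlus_adj, List.mem_cons, Prod.mk.injEq,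
    List.not_mem_nil, or_false, Set.mem_insert_iff, Set.mem_singleton_iff, Sym2.eq_iff, hx, hy,
    ne_eq, φ.apply_eq_iff_eq]
  exact adj_shuffle

theorem IsTri.nonempty_iso (hn : Fintype.card V = n) (h : IsTri G) :
    Nonempty (G ≃g extremalGraph 7 n) := by
  obtain ⟨z, a, b, c, h, rfl⟩ := h
  obtain ⟨φ, hφ⟩ := exists_equiv_fin hn ![z, a, b, c]
    (List.nodup_ofFn.1 (by simpa using h))
  refine ⟨φ, fun {x y} => ?_⟩
  have key : ∀ x, ((φ x).val = 0 ↔ x = z) ∧ ((φ x).val = 1 ↔ x = a) ∧ ((φ x).val = 2 ↔ x = b) ∧ ((φ x).val = 3 ↔ x = c) := fun x =>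
    ⟨hφ x 0, hφ x 1, hφ x 2, hφ x 3⟩
  have hx := key x
  have hy := key y
  simp only [extremalGraph, outerEdges, fromRel_adj, starPlus_adj, List.mem_cons, Prod.mk.injEq,
    List.not_mem_nil, or_false, Set.mem_insert_iff, Set.mem_singleton_iff, Sym2.eq_iff, hx, hy,
    ne_eq, φ.apply_eq_iff_eq]
  exact adj_shuffle

end Iso

/-! ### The cospectral types -/

section Cospectral

variable {V : Type*} [DecidableEq V]

/-- The orthogonal involution that acts on the coordinates `a`, `b`, `c`, `d` as half the all-ones
matrix minus the identity. -/
noncomputable def switching (a b c d : V) : Matrix V V ℝ := fun i j =>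
  if i = a ∨ i = b ∨ i = c ∨ i = d then
    ((if j = a then 1 else 0) + (if j = b then 1 else 0) + (if j = c then 1 else 0) +
      (if j = d then 1 else 0)) / 2 - (if i = j then 1 else 0)
  else if i = j then 1 else 0

theorem switching_symm {a b c d : V} (h : [a, b, c, d].Nodup) (i j : V) :
    switching a b c d i j = switching a b c d j i := by
  simp only [List.nodup_cons, List.mem_cons, not_or, List.not_mem_nil] at h
  unfold switching
  by_cases hi : i = a ∨ i = b ∨ i = c ∨ i = d
  · by_cases hj : j = a ∨ j = b ∨ j = c ∨ j = d
    · rcases hi with rfl | rfl | rfl | rfl <;> rcases hj with rfl | rfl | rfl | rfl <;> grind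
    · grind
  · grind

variable [Fintype V]

theorem switching_mul_apply (a b c d : V) (A : Matrix V V ℝ) (i j : V) :
    (switching a b c d * A) i j = if i = a ∨ i = b ∨ i = c ∨ i = d then
      (A a j + A b j + A c j + A d j) / 2 - A i j else A i j := by
  rw [Matrix.mul_apply]
  unfold switching
  split_ifs
  · simp only [sub_mul, div_mul_eq_mul_div, add_mul, Finset.sum_sub_distrib, ← Finset.sum_div,
      Finset.sum_add_distrib]
    simp
  · simp

theorem mul_switching_apply {a b c d : V} (h : [a, b, c, d].Nodup) (A : Matrix V V ℝ) (i j : V) :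
    (A * switching a b c d) i j = if j = a ∨ j = b ∨ j = c ∨ j = d then
      (A i a + A i b + A i c + A i d) / 2 - A i j else A i j := by
  have := switching_mul_apply a b c d A.transpose j i
  simp only [Matrix.mul_apply, Matrix.transpose_apply] at this ⊢
  rw [← this]
  exact Finset.sum_congr rfl fun k _ => by rw [switching_symm h, mul_comm]

theorem switching_mul_self {a b c d : V} : switching a b c d * switching a b c d = 1 := by
  ext i j
  rw [switching_mul_apply]
  by_cases hi : i = a ∨ i = b ∨ i = c ∨ i = d
  -- With J the all-ones matrix of order 4, J² = 4J, so (J/2 - 1)² = 1.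
  · rw [if_pos hi]
    simp only [switching, Matrix.one_apply, hi, true_or, or_true, if_true,
      eq_comm (a := j) (b := a), eq_comm (a := j) (b := b), eq_comm (a := j) (b := c),
      eq_comm (a := j) (b := d)]
    ring
  · rw [if_neg hi]
    simp [switching, hi, Matrix.one_apply]

theorem signlessLaplacian_eq_of_adj {G G' : SimpleGraph V} {x y : V}
    (hx : ∀ w, G.Adj x w ↔ G'.Adj x w) :
    signlessLaplacian G x y = signlessLaplacian G' x y := by
  rw [signlessLaplacian_apply, signlessLaplacian_apply, adjInd_congr (hx y)]
  simp only [realDegree, fun w => adjInd_congr (hx w)]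

theorem signlessLaplacian_comm (G : SimpleGraph V) (x y : V) :
    signlessLaplacian G x y = signlessLaplacian G y x := by
  rw [signlessLaplacian_apply, signlessLaplacian_apply, adjInd_comm]
  by_cases h : x = y
  · subst h; rfl
  · rw [if_neg h, if_neg (Ne.symm h)]

/-- A claw and a triangle lead to the same signless Laplacian Estrada index. -/
theorem SLEE_claw_eq_triangle {z a b c d : V} (h : [z, a, b, c, d].Nodup) :
    SLEE (starPlus z {s(d, a), s(d, b), s(d, c)}) =
      SLEE (starPlus z {s(a, b), s(a, c), s(b, c)}) := by
  have hnd : [a, b, c, d].Nodup := h.of_cons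
  simp only [List.nodup_cons, List.mem_cons, not_or, List.not_mem_nil] at h
  set G := starPlus z {s(d, a), s(d, b), s(d, c)} with hG
  set H := starPlus z {s(a, b), s(a, c), s(b, c)} with hH
  have adjG : ∀ x y, G.Adj x y ↔ (x = z ∨ y = z ∨ (s(x, y) = s(d, a) ∨ s(x, y) = s(d, b) ∨
      s(x, y) = s(d, c))) ∧ x ≠ y := fun x y => starPlus_adj
  have adjH : ∀ x y, H.Adj x y ↔ (x = z ∨ y = z ∨ (s(x, y) = s(a, b) ∨ s(x, y) = s(a, c) ∨
      s(x, y) = s(b, c))) ∧ x ≠ y := fun x y => starPlus_adj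
  simp only [Sym2.eq_iff] at adjG adjH
  clear_value G H
  have deg : ∀ (K : SimpleGraph V) (x : V) (s : Finset V) (m : ℕ), (∀ y, K.Adj x y ↔ y ∈ s) →
      s.card = m → realDegree K x = m := fun K x s m hs hm => by
    rw [realDegree_eq_card s hs, hm]
  have dGa := deg G a {z, d} 2 (by simp [adjG]; grind) (by grind)
  have dGb := deg G b {z, d} 2 (by simp [adjG]; grind) (by grind)
  have dGc := deg G c {z, d} 2 (by simp [adjG]; grind) (by grind)
  have dGd := deg G d {z, a, b, c} 4 (by simp [adjG]; grind) (by grind)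
  have dHa := deg H a {z, b, c} 3 (by simp [adjH]; grind) (by grind)
  have dHb := deg H b {z, a, c} 3 (by simp [adjH]; grind) (by grind)
  have dHc := deg H c {z, a, b} 3 (by simp [adjH]; grind) (by grind)
  have dHd := deg H d {z} 1 (by simp [adjH]; grind) (by grind)
  have hout : ∀ x y, ¬ (y = a ∨ y = b ∨ y = c ∨ y = d) →
      (x = a ∨ x = b ∨ x = c ∨ x = d) →
      signlessLaplacian G x y = (if y = z then 1 else 0) ∧
      signlessLaplacian H x y = (if y = z then 1 else 0) := by
    intro x y hy hx
    have hxy : x ≠ y := fun e => hy (e ▸ hx)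
    have h1 : G.Adj x y ↔ y = z := by rw [adjG]; grind
    have h2 : H.Adj x y ↔ y = z := by rw [adjH]; grind
    rw [signlessLaplacian_apply, signlessLaplacian_apply, if_neg hxy, if_neg hxy, zero_add,
      zero_add]
    simp [adjInd, h1, h2]
  -- `switching` intertwines the two matrices. Rows and columns of other vertices are constant on
  -- `a`, `b`, `c`, `d`, and constant vectors are fixed by J/2 - 1; the 4 × 4 block is checked entry
  -- by entry.
  have key : switching a b c d * signlessLaplacian H = signlessLaplacian G * switching a b c d := by
    ext i j
    rw [switching_mul_apply, mul_switching_apply hnd]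
    by_cases hi : i = a ∨ i = b ∨ i = c ∨ i = d
    · by_cases hj : j = a ∨ j = b ∨ j = c ∨ j = d
      · rw [if_pos hi, if_pos hj]
        have diag : ∀ (K : SimpleGraph V) (x : V), signlessLaplacian K x x = realDegree K x :=
          fun K x => by simp [signlessLaplacian_apply]
        have zero : ∀ (K : SimpleGraph V) (x y : V), x ≠ y → ¬ K.Adj x y →
            signlessLaplacian K x y = 0 ∧ signlessLaplacian K y x = 0 := fun K x y hxy hn => by
          rw [signlessLaplacian_comm K y x, and_self]
          simp [signlessLaplacian_apply, hxy, adjInd_of_not_adj hn]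
        have one : ∀ (K : SimpleGraph V) (x y : V), K.Adj x y →
            signlessLaplacian K x y = 1 ∧ signlessLaplacian K y x = 1 := fun K x y hn => by
          rw [signlessLaplacian_comm K y x, and_self]
          simp [signlessLaplacian_apply, hn.ne, adjInd_of_adj hn]
        rw [← diag] at dGa dGb dGc dGd dHa dHb dHc dHd
        push_cast at dGa dGb dGc dGd dHa dHb dHc dHd
        obtain ⟨Gab, Gba⟩ := zero G a b (by grind) (by rw [adjG]; grind)
        obtain ⟨Gac, Gca⟩ := zero G a c (by grind) (by rw [adjG]; grind)
        obtain ⟨Gbc, Gcb⟩ := zero G b c (by grind) (by rw [adjG]; grind)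
        obtain ⟨Gad, Gda⟩ := one G a d (by rw [adjG]; grind)
        obtain ⟨Gbd, Gdb⟩ := one G b d (by rw [adjG]; grind)
        obtain ⟨Gcd, Gdc⟩ := one G c d (by rw [adjG]; grind)
        obtain ⟨Hab, Hba⟩ := one H a b (by rw [adjH]; grind)
        obtain ⟨Hac, Hca⟩ := one H a c (by rw [adjH]; grind)
        obtain ⟨Hbc, Hcb⟩ := one H b c (by rw [adjH]; grind)
        obtain ⟨Had, Hda⟩ := zero H a d (by grind) (by rw [adjH]; grind)
        obtain ⟨Hbd, Hdb⟩ := zero H b d (by grind) (by rw [adjH]; grind)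
        obtain ⟨Hcd, Hdc⟩ := zero H c d (by grind) (by rw [adjH]; grind)
        clear deg diag zero one adjG adjH hout
        rcases hi with rfl | rfl | rfl | rfl <;> rcases hj with rfl | rfl | rfl | rfl <;> linarith
      · rw [if_pos hi, if_neg hj, (hout a j hj (by simp)).2, (hout b j hj (by simp)).2,
          (hout c j hj (by simp)).2, (hout d j hj (by simp)).2, (hout i j hj hi).1,
          (hout i j hj hi).2]
        ring
    · have hi' : ∀ w, H.Adj i w ↔ G.Adj i w := fun w => by rw [adjG, adjH]; grind
      rw [if_neg hi, signlessLaplacian_eq_of_adj hi']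
      by_cases hj : j = a ∨ j = b ∨ j = c ∨ j = d
      · rw [if_pos hj]
        simp only [signlessLaplacian_comm G i]
        rw [(hout a i hi (by simp)).1, (hout b i hi (by simp)).1,
          (hout c i hi (by simp)).1, (hout d i hi (by simp)).1, (hout j i hi hj).1]
        ring
      · rw [if_neg hj]
  refine SLEE_eq_of_trace_pow fun k => ?_
  refine trace_pow_of_conj (P := switching a b c d) (P' := switching a b c d)
    switching_mul_self ?_ k
  rw [key, Matrix.mul_assoc, switching_mul_self, Matrix.mul_one]

end Cospectral

/-! ### Maximal graphs -/

section Maximal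

variable {V : Type*} [Fintype V] [DecidableEq V]

/-- A graph with the property `P` that has the largest Estrada index among such graphs. -/
def IsMaximizer (P : SimpleGraph V → Prop) (M : SimpleGraph V) : Prop :=
  P M ∧ ∀ G, P G → SLEE G ≤ SLEE M

theorem exists_isMaximizer {P : SimpleGraph V → Prop} {G : SimpleGraph V} (hG : P G) :
    ∃ M, IsMaximizer P M :=
  Set.exists_max_image {G | P G} SLEE (Set.toFinite _) ⟨G, hG⟩

theorem IsMaximizer.of_le {P : SimpleGraph V → Prop} {G M : SimpleGraph V} (hM : IsMaximizer P M)
    (hG : P G) (hle : SLEE M ≤ SLEE G) : IsMaximizer P G :=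
  ⟨hG, fun _ h => (hM.2 _ h).trans hle⟩

theorem IsMaximizer.type {P : SimpleGraph V → Prop} {M : SimpleGraph V} (hM : IsMaximizer P M)
    (htri : IsTricyclic M)
    (hP : ∀ G' u v, IsKelmans M G' u v → M.Adj u v → P G') :
    IsThreeEdges M ∨ IsPathEdge M ∨ IsPath M ∨ IsClaw M ∨ IsTri M := by
  have := htri.1.nonempty
  obtain ⟨z, hz⟩ := Finite.exists_max (realDegree M)
  refine type_of_dominating htri (z := z) fun x hx => ?_
  by_contra hzx
  obtain ⟨G', v, hk, hzv, hlt⟩ := exists_isKelmans_of_not_dominating htri.1 hz ⟨x, hx, hzx⟩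
  exact absurd (hM.2 G' (hP G' z v hk hzv)) (not_le.2 hlt)

theorem isClaw_or_isTri_of_isMaximizer {M : SimpleGraph V}
    (hM : IsMaximizer IsTricyclic M) : IsClaw M ∨ IsTri M := by
  have lt : ∀ G', IsTricyclic G' → ¬ SLEE M < SLEE G' := fun G' hG' => not_lt.2 (hM.2 G' hG')
  rcases hM.type hM.1 (fun G' u v hk huv => hk.isTricyclic huv hM.1) with h | h | h | h
  · obtain ⟨G', hG', hlt⟩ := h.exists_lt
    exact absurd hlt (lt _ hG'.isTricyclic)
  · obtain ⟨G', hG', hlt⟩ := h.exists_lt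
    exact absurd hlt (lt _ hG'.isTricyclic)
  · obtain ⟨G', hG', hlt⟩ := h.exists_lt
    exact absurd hlt (lt _ hG'.isTricyclic)
  · exact h

theorem isPathEdge_of_isMaximizer {M : SimpleGraph V}
    (hM : IsMaximizer (fun G => IsTricyclic G ∧ ∃ c, IsColoop G c) M) : IsPathEdge M := by
  obtain ⟨c, hc⟩ := hM.1.2
  rcases hM.type hM.1.1 (fun G' u v hk huv => ⟨hk.isTricyclic huv hM.1.1,
    hk.exists_isColoop huv hM.1.2⟩) with h | h | h | h | h
  · obtain ⟨G', hG', hlt⟩ := h.exists_lt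
    -- The better graph stays in the class because its four cycles force a coloop.
    exact absurd hlt (not_lt.2 (hM.2 G' ⟨hG'.isTricyclic,
      exists_isColoop_of_numCycles_le hG'.isTricyclic hG'.numCycles_eq.le⟩))
  · exact h
  · exact absurd hc (h.not_isColoop c)
  · exact absurd hc (h.not_isColoop c)
  · exact absurd hc (h.not_isColoop c)

theorem isThreeEdges_of_isMaximizer {M : SimpleGraph V}
    (hM : IsMaximizer (fun G => IsTricyclic G ∧
      ∃ c₁ c₂, IsColoop G c₁ ∧ IsColoop G c₂ ∧ c₁ ≠ c₂) M) : IsThreeEdges M := by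
  obtain ⟨c₁, c₂, h₁, h₂, hne⟩ := hM.1.2
  rcases hM.type hM.1.1 (fun G' u v hk huv => ⟨hk.isTricyclic huv hM.1.1,
    hk.exists_two_isColoop huv hM.1.2⟩) with h | h | h | h | h
  · exact h
  · exact absurd (h.coloop_unique h₁ h₂) hne
  · exact absurd h₁ (h.not_isColoop c₁)
  · exact absurd h₁ (h.not_isColoop c₁)
  · exact absurd h₁ (h.not_isColoop c₁)

theorem IsClaw.exists_isTri {M : SimpleGraph V} (h : IsClaw M) :
    ∃ G : SimpleGraph V, IsTri G ∧ SLEE M = SLEE G := by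
  obtain ⟨z, a, b, c, d, h, rfl⟩ := h
  simp only [List.nodup_cons, List.mem_cons, not_or, List.not_mem_nil] at h
  exact ⟨_, ⟨z, b, c, d, by simp; grind, rfl⟩, SLEE_claw_eq_triangle (by simp; grind)⟩

theorem IsTri.exists_isClaw {G M : SimpleGraph V} (h : IsTri M) (hM : IsTricyclic M)
    (hG : IsTricyclic G) (hne : G ≠ M) :
    ∃ G' : SimpleGraph V, IsClaw G' ∧ SLEE M = SLEE G' := by
  obtain ⟨z, a, b, c, h, rfl⟩ := h
  simp only [List.nodup_cons, List.mem_cons, not_or, List.not_mem_nil] at h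
  -- A claw needs a fifth vertex. Without one, `M` is the complete graph and contains `G`, and equal
  -- edge numbers give `G = M`.
  by_cases hd : ∃ d, d ≠ z ∧ d ≠ a ∧ d ≠ b ∧ d ≠ c
  · obtain ⟨d, hd⟩ := hd
    exact ⟨_, ⟨z, d, a, b, c, by simp; grind, rfl⟩, (SLEE_claw_eq_triangle (by simp; grind)).symm⟩
  · push Not at hd
    refine absurd (SimpleGraph.edgeSet_injective (Set.eq_of_subset_of_ncard_le ?_ ?_)) hne
    · refine SimpleGraph.edgeSet_mono fun x y hxy => ?_
      have := hd x
      have := hd y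
      have := hxy.ne
      simp only [starPlus_adj, Set.mem_insert_iff, Set.mem_singleton_iff, Sym2.eq_iff]
      grind
    · rw [hM.2, hG.2]

end Maximal

end Tricyclic

/-! ### The main theorem -/

theorem theorem1 {V : Type*} [Fintype V] [DecidableEq V] (n j : ℕ)
    (hn : Fintype.card V = n)
    (hj : j = 3 ∨ j = 4 ∨ j = 6 ∨ j = 7)
    (G : SimpleGraph V)
    (hG : Tricyclic.IsTricyclic G)
    (hGj : Tricyclic.numCycles G = j)
    (hmax : ∀ G' : SimpleGraph V, Tricyclic.IsTricyclic G' → Tricyclic.numCycles G' = j →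
      Tricyclic.SLEE G' ≤ Tricyclic.SLEE G) :
    Nonempty (G ≃g Tricyclic.extremalGraph j n) := by
  open Tricyclic in
  rcases hj with rfl | rfl | rfl | rfl
  · have hP := And.intro hG (exists_two_isColoop_of_numCycles_le hG hGj.le)
    obtain ⟨M, hM⟩ := exists_isMaximizer
      (P := fun G => IsTricyclic G ∧ ∃ c₁ c₂, IsColoop G c₁ ∧ IsColoop G c₂ ∧ c₁ ≠ c₂) hP
    -- The maximiser `M` of the larger class has exactly three cycles, so `hmax` applies to it and
    -- `G` is a maximiser of that class too.
    exact (isThreeEdges_of_isMaximizer (hM.of_le hP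
      (hmax M hM.1.1 (isThreeEdges_of_isMaximizer hM).numCycles_eq))).nonempty_iso hn
  · have hP := And.intro hG (exists_isColoop_of_numCycles_le hG hGj.le)
    obtain ⟨M, hM⟩ := exists_isMaximizer (P := fun G => IsTricyclic G ∧ ∃ c, IsColoop G c) hP
    exact (isPathEdge_of_isMaximizer (hM.of_le hP
      (hmax M hM.1.1 (isPathEdge_of_isMaximizer hM).numCycles_eq))).nonempty_iso hn
  · obtain ⟨M, hM⟩ := exists_isMaximizer hG
    -- If `M` has seven cycles instead of six, its cospectral claw is compared with `G`; for j = 7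
    -- the roles are exchanged. The number of cycles then decides between the two types.
    have hle : SLEE M ≤ SLEE G := by
      rcases isClaw_or_isTri_of_isMaximizer hM with h | h
      · exact hmax M hM.1 h.numCycles_eq
      · obtain ⟨G', hG', heq⟩ := h.exists_isClaw hM.1 hG (by
          rintro rfl
          have := h.numCycles_eq
          omega)
        exact heq.trans_le (hmax G' hG'.isTricyclic hG'.numCycles_eq)
    rcases isClaw_or_isTri_of_isMaximizer (hM.of_le hG hle) with h | h
    · exact h.nonempty_iso hn
    · have := h.numCycles_eq
      omega
  · obtain ⟨M, hM⟩ := exists_isMaximizer hG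
    have hle : SLEE M ≤ SLEE G := by
      rcases isClaw_or_isTri_of_isMaximizer hM with h | h
      · obtain ⟨G', hG', heq⟩ := h.exists_isTri
        exact heq.trans_le (hmax G' hG'.isTricyclic hG'.numCycles_eq)
      · exact hmax M hM.1 h.numCycles_eq
    rcases isClaw_or_isTri_of_isMaximizer (hM.of_le hG hle) with h | h
    · have := h.numCycles_eq
      omega
    · exact h.nonempty_iso hn
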